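/- For real numbers $\ell_-,\ell_+\ge 1$ and $c\in\mathbb{R}$ let $f_c=f_{c,\ell_-,\ell_+}:\mathbb{R}\to\mathbb{R}$ be the unimodal map $$f_c(x)=\begin{cases}|x|^{\ell_-}+c & \text{if } x\le 0,\\ |x|^{\ell_+}+c & \text{if } x\ge 0.\end{cases}$$ The kneading sequence of a map $f:\mathbb{R}\to\mathbb{R}$ is the word $i_1i_2\cdots\in\{-1,0,1\}^{\mathbb{Z}^+}$ in which $i_k$ is the sign of $f^k(0)$. By a periodic kneading sequence of period $q\ge 1$ we mean a word $\mathbf{i}=i_1i_2\cdots\in\{-1,0,1\}^{\mathbb{Z}^+}$ with $i_{k+q}=i_k$ for all $k\ge 1$, $i_q=0$, and $i_j\ne 0$ for $1\le j<q$; thus a map has such a kneading sequence only if its critical point $0$ is periodic of exact period $q$. For every integer $L\ge 1$ there is a real number $\ell_0>1$, depending only on $L$, such that for every $q\ge 1$, every periodic kneading sequence $\mathbf{i}$ of period $q$ with $$\#\{1\le j<q : i_j=-1\}\le L,$$ and every pair of real numbers $\ell_-,\ell_+\ge \ell_0$, there is at most one $c\in\mathbb{R}$ for which the kneading sequence of $f_c=f_{c,\ell_-,\ell_+}$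 is equal to $\mathbf{i}$. Moreover, for any such $c$ one has $Df_c^n(c)\ne 0$ for all $0\le n<q$, and $$\sum_{n=0}^{q-1}\frac{1}{Df_c^n(c)}>0,$$ where $Df_c^n(c)$ is the derivative of the $n$-th iterate of $f_c$ at the point $c$. -/

import Mathlib

/-- The unimodal map `f_c = f_{c,ℓ₋,ℓ₊} : ℝ → ℝ`, equal to `|x|^ℓ₋ + c` for `x ≤ 0` and to
`|x|^ℓ₊ + c` for `x ≥ 0` (for `ℓ₋, ℓ₊ ≠ 0` the two formulas agree at `x = 0`). -/
noncomputable def unimodalMap (ℓm ℓp c : ℝ) (x : ℝ) : ℝ :=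
  if x ≤ 0 then |x| ^ ℓm + c else |x| ^ ℓp + c

/-- The Milnor–Thurston kneading sequence `i₁ i₂ ⋯` of `f`, where `i_k ∈ {-1, 0, 1}` is the sign
of `f^k(0)`, `k ≥ 1`. -/
noncomputable def kneadingSequence (f : ℝ → ℝ) (k : ℕ+) : SignType :=
  SignType.sign (f^[(k : ℕ)] 0)

/-- `i = i₁ i₂ ⋯` is a periodic kneading sequence of period `q`, i.e. the kind of sequence that
belongs to a map whose critical point `0` is periodic with exact period `q`: the word `i` is
periodic with period `q`, and its first entry `0` is `i_q`. -/
structure IsPeriodicKneading (i : ℕ+ → SignType) (q : ℕ+) : Prop where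
  periodic : ∀ k : ℕ+, i (k + q) = i k
  zero_at : i q = 0
  ne_zero_before : ∀ j : ℕ+, j < q → i j ≠ 0

/-! The critical orbit `x 1, …, x q = 0` is a fixed point of a pullback operator on configurations:
the pullback `y'` of `y` has `|y' j| ^ ℓ j = y (j + 1) - y 1`, with the sign of `y' j` prescribed by
the kneading sequence, and `y' q = 0`. Everything follows once relative velocities `(v j - v k) / (y
j - y k)` of tangent vectors decay geometrically under pullback, uniformly over ordered
configurations (`exists_velBound_decay`).

Uniqueness: two critical orbits with the same kneading sequence are ordered alike
(`orbit_lt_of_lt`), so the segment between them can be pulled back repeatedly. Its end points stay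
fixed while the speed of the first coordinate tends to `0`, so the parameters agree
(`Comparable.first_eq`). Positivity: a zero `τ ∈ (0, 1]` of `∑ τ ^ n / Df^n(c)` yields an
eigenvector of the linearised pullback with eigenvalue `1 / τ ≥ 1`, against the decay
(`sum_pow_div_ne_zero`); the sum is `1` at `τ = 0`, hence positive at `τ = 1`.

Decay: velocity relative to the critical point gains a factor `1 / ℓ` per pullback, which also
controls pairs on opposite sides of `0`. On one side of `0`, the relative velocity of a pair is at
most `σ ≤ 1` times the sum of that of the successor pair and that of one successor and the critical
value; `σ` is small unless the successors' distances to the critical value agree within a factor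
`exp κ`. In this bad case positive successors cost a term that is geometrically small in the length
of the coming positive run, while negative successors produce two pairs instead of one. To bound
these branchings, a third index `t` advances with the pairs and shadows all of them (`Shadows`). In
the bad case `t` has the sign of the pair and is not `q`, so each negative stage uses up one of the
at most `L` negative entries. The total loss depends on `L` alone (`negEstimate`, `posEstimate`) and
is beaten by large exponents. -/

/-! ### Elementary inequalities for powers. -/

theorem rpow_quot_le_one {ℓ ρ : ℝ} (hℓ : 1 ≤ ℓ) (h0 : 0 < ρ) (h1 : ρ < 1) :
    (1 - ρ ^ ℓ) / (ℓ * (1 - ρ)) ≤ 1 := by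
  have hb := one_add_mul_self_le_rpow_one_add (s := ρ - 1) (by linarith) hℓ
  rw [div_le_one (by nlinarith)]
  have : 1 + (ρ - 1) = ρ := by ring
  rw [this] at hb
  linarith

/-- The numerator is at most `1`, and `ρ ≤ exp (-(κ / ℓ))` keeps `1 - ρ` above `κ / (ℓ + κ)`. The
quotient is the factor `σ` of the one-step estimate; this is where it becomes small. -/
theorem rpow_quot_le_of_le_exp {ℓ ρ κ : ℝ} (hℓ : 1 ≤ ℓ) (h0 : 0 < ρ) (h1 : ρ < 1) (hκ : 0 < κ)
    (hρ : ρ ^ ℓ ≤ Real.exp (-κ)) :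
    (1 - ρ ^ ℓ) / (ℓ * (1 - ρ)) ≤ 1 / κ + 1 / ℓ := by
  have hℓ0 : 0 < ℓ := by linarith
  have hlog : ℓ * Real.log ρ ≤ -κ := by
    have := Real.log_le_log (by positivity) hρ
    rwa [Real.log_rpow h0, Real.log_exp] at this
  have hρ' : ρ ≤ Real.exp (-(κ / ℓ)) := by
    rw [← Real.log_le_iff_le_exp h0]
    have : Real.log ρ ≤ (-κ) / ℓ := by
      rw [le_div_iff₀ hℓ0]; linarith
    rwa [neg_div] at this
  have hexp : Real.exp (-(κ / ℓ)) ≤ 1 / (1 + κ / ℓ) := by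
    rw [Real.exp_neg, ← one_div]
    have := Real.add_one_le_exp (κ / ℓ)
    have h2 : 0 < κ / ℓ := by positivity
    exact one_div_le_one_div_of_le (by linarith) (by linarith)
  have h3 : κ / (ℓ + κ) ≤ 1 - ρ := by
    have : 1 / (1 + κ / ℓ) = 1 - κ / (ℓ + κ) := by field_simp; ring
    linarith
  have h4 : 1 / κ + 1 / ℓ = 1 / (ℓ * (κ / (ℓ + κ))) := by field_simp
  have h5 : 0 < κ / (ℓ + κ) := by positivity
  rw [h4]
  have h6 : 0 < ρ ^ ℓ := by positivity
  exact div_le_div₀ (by norm_num) (by linarith) (by positivity)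
    (mul_le_mul_of_nonneg_left h3 hℓ0.le)

/-- The logarithmic derivative of a difference of `ℓ`-th roots, in terms of those of the
radicands and of their difference. -/
theorem abs_root_diff_le {ℓ x y a b : ℝ} (hℓ : 1 ≤ ℓ) (hy : 0 < y) (hxy : y < x) :
    |(x * (a / x ^ ℓ / ℓ) - y * (b / y ^ ℓ / ℓ)) / (x - y)| ≤
      (1 - (y / x) ^ ℓ) / (ℓ * (1 - y / x)) *
        (|(a - b) / (x ^ ℓ - y ^ ℓ)| + |b / y ^ ℓ|) := by
  have hx : 0 < x := hy.trans hxy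
  have hℓ0 : 0 < ℓ := by linarith
  set A := x ^ ℓ with hA
  set B := y ^ ℓ with hB
  have hB0 : 0 < B := by positivity
  have hBA : B < A := Real.rpow_lt_rpow hy.le hxy hℓ0
  have hA0 : 0 < A := hB0.trans hBA
  have hr : (y / x) ^ ℓ = B / A := Real.div_rpow hy.le hx.le ℓ
  rw [hr]
  set σ := (1 - B / A) / (ℓ * (1 - y / x)) with hσ
  have hρ1 : y / x < 1 := (div_lt_one hx).2 hxy
  have hden : 0 < ℓ * (1 - y / x) := mul_pos hℓ0 (by linarith)
  have hr1 : B / A < 1 := (div_lt_one hA0).2 hBA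
  have hσ0 : 0 ≤ σ := div_nonneg (by linarith) hden.le
  have hσp : 1 / ℓ ≤ σ := by
    have h1 : B / A ≤ y / x := by
      rw [← hr]
      calc (y / x) ^ ℓ ≤ (y / x) ^ (1 : ℝ) :=
            Real.rpow_le_rpow_of_exponent_ge (by positivity) hρ1.le hℓ
        _ = y / x := Real.rpow_one _
    rw [hσ, div_le_div_iff₀ hℓ0 hden]
    nlinarith
  -- An exact combination whose two coefficients have size at most `σ`, thanks to `hσp`.
  have key : (x * (a / A / ℓ) - y * (b / B / ℓ)) / (x - y) =
      σ * ((a - b) / (A - B)) - (σ - 1 / ℓ) * (b / B) := by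
    have h1 : x - y ≠ 0 := by linarith
    have h2 : A - B ≠ 0 := by linarith
    have h3 : (1 - y / x) = (x - y) / x := by field_simp
    rw [hσ, h3]
    field_simp
    ring
  rw [key]
  have hp : 0 < 1 / ℓ := by positivity
  calc _ ≤ |σ * ((a - b) / (A - B))| + |(σ - 1 / ℓ) * (b / B)| := abs_sub _ _
    _ = σ * |(a - b) / (A - B)| + (σ - 1 / ℓ) * |b / B| := by
        rw [abs_mul, abs_mul, abs_of_nonneg hσ0, abs_of_nonneg (sub_nonneg.2 hσp)]
    _ ≤ _ := by
        have := abs_nonneg (b / B)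
        nlinarith

theorem jensen_two_rpow {R w t : ℝ} (hR : 1 ≤ R) (hw0 : 0 ≤ w) (hw1 : w ≤ 1) (ht : 0 ≤ t) :
    (w * t + (1 - w)) ^ R ≤ w * t ^ R + (1 - w) := by
  have := (convexOn_rpow hR).2 (x := t) ht (y := 1) (by simp) hw0 (sub_nonneg.2 hw1) (by ring)
  simpa using this

/-- Passing from ratios of `· + a` to ratios of `·` improves a power bound. -/
theorem le_mul_div_rpow_of_add {a X Y Z R : ℝ} (ha : 0 < a) (hX : 0 < X) (hY : 0 < Y) (hR : 1 ≤ R)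
    (h : Z + a ≤ (X + a) * ((Y + a) / (X + a)) ^ R) : Z ≤ X * (Y / X) ^ R := by
  have hXa : 0 < X + a := by positivity
  -- With these weights `(Y + a) / (X + a)` is the average of `Y / X` and `1`.
  have hj := jensen_two_rpow (w := X / (X + a)) (t := Y / X) hR (by positivity)
    ((div_le_one hXa).2 (by linarith)) (by positivity)
  have h1 : X / (X + a) * (Y / X) + (1 - X / (X + a)) = (Y + a) / (X + a) := by
    field_simp; ring
  rw [h1] at hj
  have h2 := mul_le_mul_of_nonneg_left hj hXa.le
  have h3 : (X + a) * (X / (X + a) * (Y / X) ^ R + (1 - X / (X + a))) =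
      X * (Y / X) ^ R + a := by
    field_simp; ring
  linarith

/-- By convexity of the power: `y` is the fraction `1 / R` of the way from `x` to `x - R * (x - y)`,
and `z` is not below the latter. -/
theorem rpow_sub_le_of_linear {ℓ R x y z : ℝ} (hℓ : 1 ≤ ℓ) (hR : 1 ≤ R) (hz : 0 ≤ x - R * (x - y))
    (hyx : y ≤ x) (h : x - z ≤ R * (x - y)) :
    x ^ ℓ - z ^ ℓ ≤ R * (x ^ ℓ - y ^ ℓ) := by
  have hR0 : 0 < R := by linarith
  have hx : 0 ≤ x := by nlinarith
  have hc := (convexOn_rpow hℓ).2 (show x ∈ Set.Ici 0 from hx)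
    (show x - R * (x - y) ∈ Set.Ici 0 from hz)
    (show 0 ≤ 1 - 1 / R by rw [sub_nonneg, div_le_one hR0]; exact hR)
    (show 0 ≤ 1 / R by positivity) (by ring)
  simp only [smul_eq_mul] at hc
  have h1 : (1 - 1 / R) * x + 1 / R * (x - R * (x - y)) = y := by field_simp; ring
  rw [h1] at hc
  have h2 : (x - R * (x - y)) ^ ℓ ≤ z ^ ℓ := Real.rpow_le_rpow hz (by linarith) (by linarith)
  have h3 := mul_le_mul_of_nonneg_left hc hR0.le
  have h4 : R * ((1 - 1 / R) * x ^ ℓ + 1 / R * (x - R * (x - y)) ^ ℓ) =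
      (R - 1) * x ^ ℓ + (x - R * (x - y)) ^ ℓ := by field_simp
  linarith

theorem le_mul_div_rpow_of_linear {R x y z : ℝ} (hR : 1 ≤ R) (hx : 0 < x) (hxy : x ≤ y)
    (h : z - x ≤ R * (y - x)) : z ≤ x * (y / x) ^ R := by
  have hb := one_add_mul_self_le_rpow_one_add (s := y / x - 1)
    (by have : 0 ≤ y / x := by have := hx.le.trans hxy; positivity
        linarith) hR
  rw [add_sub_cancel] at hb
  have := mul_le_mul_of_nonneg_left hb hx.le
  have h2 : x * (1 + R * (y / x - 1)) = x + R * (y - x) := by field_simp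
  linarith

/-- Bernoulli's inequality at `ρ⁻¹`, multiplied by `ρ ^ R`. It turns a power bound into a linear one
when the ratio is bounded. -/
theorem rpow_sub_one_le {ρ R K : ℝ} (hρ : 1 ≤ ρ) (hR : 1 ≤ R) (hK : ρ ≤ K) :
    ρ ^ R - 1 ≤ R * K ^ R * (ρ - 1) := by
  have h0 : 0 < ρ := by linarith
  have hb := one_add_mul_self_le_rpow_one_add (s := 1 / ρ - 1)
    (by have : 0 ≤ 1 / ρ := by positivity
        linarith) hR
  rw [add_sub_cancel, one_div, Real.inv_rpow h0.le] at hb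
  have hp : 0 < ρ ^ R := by positivity
  have h1 := mul_le_mul_of_nonneg_left hb hp.le
  rw [mul_inv_cancel₀ hp.ne'] at h1
  have h2 : ρ ^ R - 1 ≤ ρ ^ R * R * (1 - ρ⁻¹) := by linarith
  have h3 : 1 - ρ⁻¹ ≤ ρ - 1 := by
    have : ρ * ρ⁻¹ = 1 := mul_inv_cancel₀ h0.ne'
    nlinarith [inv_pos.2 h0]
  have h4 : ρ ^ R ≤ K ^ R := Real.rpow_le_rpow h0.le hK (by linarith)
  have h5 : 0 ≤ 1 - ρ⁻¹ := by
    have := inv_le_one_of_one_le₀ hρ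
    linarith
  have h6 : 0 ≤ K ^ R * R := mul_nonneg (hp.le.trans h4) (by linarith)
  calc _ ≤ ρ ^ R * R * (1 - ρ⁻¹) := h2
    _ ≤ K ^ R * R * (ρ - 1) := by gcongr
    _ = _ := by ring

/-! ### Shadowing of a pair of points by a third. -/

/-- The point at distance `z` from the critical point stays within a controlled multiple `R` of
the gap between `x` and `y`, on the side of `y` as seen from `x`. -/
def Shadows (R x y z : ℝ) : Prop :=
  (0 < x ∧ x < y ∧ x ≤ z ∧ z ≤ x * (y / x) ^ R) ∨
    (0 < y ∧ y < x ∧ z ≤ x ∧ x - z ≤ R * (x - y))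

theorem Shadows.refl {R x y : ℝ} (hR : 1 ≤ R) (hx : 0 < x) (hy : 0 < y) (hxy : x ≠ y) :
    Shadows R x y x := by
  rcases lt_or_gt_of_ne hxy with h | h
  · refine Or.inl ⟨hx, h, le_rfl, le_mul_of_one_le_right hx.le ?_⟩
    exact Real.one_le_rpow ((one_le_div hx).2 h.le) (by linarith)
  · exact Or.inr ⟨hy, h, le_rfl, by nlinarith⟩

theorem Shadows.pos {R x y z : ℝ} (h : Shadows R x y z) : 0 < x ∧ 0 < y := by
  rcases h with ⟨hx, hlt, -⟩ | ⟨hy, hlt, -⟩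
  exacts [⟨hx, hx.trans hlt⟩, ⟨hy.trans hlt, hy⟩]

/-- This explains the two shapes in `Shadows`: the outward power bound passes to `ℓ`-th powers
verbatim, and the inward linear bound passes by convexity. Inward, `z` cannot reach `0`, since the
ratio bound and `hsmall` give `R * (x - y) ≤ x / 2`. -/
theorem Shadows.pow {R x y z ℓ κ : ℝ} (h : Shadows R x y z) (hR : 1 ≤ R) (hℓ : 1 ≤ ℓ)
    (hsmall : R * (1 - Real.exp (-(κ / ℓ))) ≤ 1 / 2)
    (hxy : x ^ ℓ ≤ Real.exp κ * y ^ ℓ) :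
    0 < z ∧ ((x ^ ℓ < y ^ ℓ ∧ x ^ ℓ ≤ z ^ ℓ ∧ z ^ ℓ ≤ x ^ ℓ * (y ^ ℓ / x ^ ℓ) ^ R) ∨
      (y ^ ℓ < x ^ ℓ ∧ z ^ ℓ ≤ x ^ ℓ ∧ x ^ ℓ - z ^ ℓ ≤ R * (x ^ ℓ - y ^ ℓ))) := by
  have hℓ0 : 0 < ℓ := by linarith
  rcases h with ⟨hx, hlt, hxz, hz⟩ | ⟨hy, hlt, hzx, hz⟩
  · have hz0 : 0 < z := hx.trans_le hxz
    refine ⟨hz0, Or.inl ⟨Real.rpow_lt_rpow hx.le hlt hℓ0, Real.rpow_le_rpow hx.le hxz hℓ0.le, ?_⟩⟩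
    have hq : 0 ≤ y / x := div_nonneg (hx.trans hlt).le hx.le
    calc z ^ ℓ ≤ (x * (y / x) ^ R) ^ ℓ := Real.rpow_le_rpow hz0.le hz hℓ0.le
      _ = x ^ ℓ * (y ^ ℓ / x ^ ℓ) ^ R := by
        rw [Real.mul_rpow hx.le (by positivity), ← Real.rpow_mul hq, mul_comm R,
          Real.rpow_mul hq, Real.div_rpow (hx.trans hlt).le hx.le]
  · have hx : 0 < x := hy.trans hlt
    have h1 : Real.exp (-(κ / ℓ)) * x ≤ y := by
      refine le_of_not_gt fun hcon => ?_
      have h2 := Real.rpow_lt_rpow hy.le hcon hℓ0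
      rw [Real.mul_rpow (Real.exp_pos _).le hx.le, ← Real.exp_mul] at h2
      have h3 : -(κ / ℓ) * ℓ = -κ := by field_simp
      rw [h3] at h2
      have h4 := mul_lt_mul_of_pos_left h2 (Real.exp_pos κ)
      rw [← mul_assoc, ← Real.exp_add, add_neg_cancel, Real.exp_zero, one_mul] at h4
      linarith
    have h2 : R * (x - y) ≤ x / 2 := by
      have : R * (x - y) ≤ R * ((1 - Real.exp (-(κ / ℓ))) * x) := by
        apply mul_le_mul_of_nonneg_left _ (by linarith)
        linarith
      nlinarith
    have hz0 : 0 < z := by linarith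
    exact ⟨hz0, Or.inr ⟨Real.rpow_lt_rpow hy.le hlt hℓ0, Real.rpow_le_rpow hz0.le hzx hℓ0.le,
      rpow_sub_le_of_linear hℓ hR (by linarith) hlt.le hz⟩⟩

/-- Subtracting `a` leaves the linear clause unchanged and improves the power clause, so no constant
is lost when the successors are positive. -/
theorem Shadows.image_pos {R a x y z ℓ κ X Y Z : ℝ} (h : Shadows R x y z) (hR : 1 ≤ R)
    (hℓ : 1 ≤ ℓ) (hsmall : R * (1 - Real.exp (-(κ / ℓ))) ≤ 1 / 2)
    (hxy : x ^ ℓ ≤ Real.exp κ * y ^ ℓ) (ha : 0 < a) (hX0 : 0 < X) (hY0 : 0 < Y)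
    (hX : x ^ ℓ = X + a) (hY : y ^ ℓ = Y + a) (hZ : z ^ ℓ = Z + a) : Shadows R X Y Z := by
  obtain ⟨-, h | h⟩ := h.pow hR hℓ hsmall hxy
  · rw [hX, hY, hZ] at h
    exact Or.inl ⟨hX0, by linarith, by linarith, le_mul_div_rpow_of_add ha hX0 hY0 hR h.2.2⟩
  · rw [hX, hY, hZ] at h
    exact Or.inr ⟨hY0, by linarith, by linarith, by linarith⟩

/-- The growth of the constant in `Shadows` when the orbit passes to the left of `0`. -/
noncomputable def shadowGrowth (κ R : ℝ) : ℝ := R * Real.exp (κ * R)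

theorem le_shadowGrowth {κ R : ℝ} (hκ : 0 ≤ κ) (hR : 0 ≤ R) : R ≤ shadowGrowth κ R :=
  le_mul_of_one_le_right hR (Real.one_le_exp (by positivity))

theorem exp_le_shadowGrowth {κ R : ℝ} (hR : 1 ≤ R) : Real.exp (κ * R) ≤ shadowGrowth κ R :=
  le_mul_of_one_le_left (Real.exp_pos _).le hR

/-- To the left of `0` inward and outward are exchanged, so the two clauses must be converted into
each other by Bernoulli's inequality; this is where the constant grows. The second conclusion serves
the pair made of the critical value, at distance `a`, and the lower of the two successors. -/
theorem Shadows.image_neg {R a x y z ℓ κ X Y Z : ℝ} (h : Shadows R x y z) (hR : 1 ≤ R)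
    (hκ : 0 ≤ κ) (hℓ : 1 ≤ ℓ) (hsmall : R * (1 - Real.exp (-(κ / ℓ))) ≤ 1 / 2)
    (hxy : x ^ ℓ ≤ Real.exp κ * y ^ ℓ) (hyx : y ^ ℓ ≤ Real.exp κ * x ^ ℓ)
    (hX0 : X < 0) (hY0 : Y < 0)
    (hX : x ^ ℓ = X + a) (hY : y ^ ℓ = Y + a) (hZ : z ^ ℓ = Z + a) :
    Shadows (shadowGrowth κ R) (-X) (-Y) (-Z) ∧
      Shadows (shadowGrowth κ R) a (-(min X Y)) (-Z) := by
  have hXa : 0 < X + a := hX ▸ Real.rpow_pos_of_pos h.pos.1 ℓ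
  have hYa : 0 < Y + a := hY ▸ Real.rpow_pos_of_pos h.pos.2 ℓ
  obtain ⟨hz0, h⟩ := h.pow hR hℓ hsmall hxy
  have hZa : 0 < Z + a := hZ ▸ Real.rpow_pos_of_pos hz0 ℓ
  have hS := exp_le_shadowGrowth (κ := κ) hR
  have hRS := le_shadowGrowth hκ (by linarith : 0 ≤ R)
  rw [hX, hY, hZ] at h
  rw [hX, hY] at hxy
  rw [hX, hY] at hyx
  rcases h with h | h
  · have hXa : 0 < X + a := by
      by_contra hcon
      have := Real.exp_pos κ
      nlinarith
    have hρ : (Y + a) / (X + a) ≤ Real.exp κ := by rwa [div_le_iff₀ hXa]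
    have hρ1 : 1 ≤ (Y + a) / (X + a) := (one_le_div hXa).2 h.1.le
    have h1 := rpow_sub_one_le hρ1 hR hρ
    rw [← Real.exp_mul] at h1
    have h2 := mul_le_mul_of_nonneg_left h1 hXa.le
    have h3 : (X + a) * (R * Real.exp (κ * R) * ((Y + a) / (X + a) - 1)) =
        shadowGrowth κ R * (Y - X) := by
      unfold shadowGrowth; field_simp; ring
    rw [min_eq_left (by linarith)]
    refine ⟨Or.inr ⟨by linarith, by linarith, by linarith, by linarith⟩,
      Or.inr ⟨by linarith, by linarith, by linarith, ?_⟩⟩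
    have h4 : ((Y + a) / (X + a)) ^ R ≤ Real.exp (κ * R) := by
      rw [Real.exp_mul]
      exact Real.rpow_le_rpow (by linarith) hρ (by linarith)
    have h5 := mul_le_mul_of_nonneg_left (h4.trans hS) hXa.le
    linarith
  · have hYa : 0 < Y + a := by
      by_contra hcon
      have := Real.exp_pos κ
      nlinarith
    rw [min_eq_right (by linarith)]
    refine ⟨Or.inl ⟨by linarith, by linarith, by linarith, ?_⟩,
      Or.inr ⟨by linarith, by linarith, by linarith, ?_⟩⟩
    · refine le_mul_div_rpow_of_linear (by linarith) (by linarith) (by linarith) ?_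
      nlinarith
    · have h6 : Real.exp κ ≤ Real.exp (κ * R) := Real.exp_le_exp.2 (by nlinarith)
      nlinarith

/-! ### Runs of positive entries, pullback orbits and relative velocities. -/

/-- The number of consecutive positive entries of `x` from the index `j` on. -/
noncomputable def plusRun (x : ℕ → ℝ) (j : ℕ) : ℕ := sInf {h | x (j + h) ≤ 0}

theorem plusRun_of_nonpos {x : ℕ → ℝ} {j : ℕ} (h : x j ≤ 0) : plusRun x j = 0 :=
  Nat.sInf_eq_zero.2 (Or.inl h)

theorem plusRun_of_pos {x : ℕ → ℝ} {j q : ℕ} (hq : x q ≤ 0) (hj : j ≤ q) (h : 0 < x j) :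
    plusRun x j = plusRun x (j + 1) + 1 := by
  have hne : {h | x (j + h) ≤ 0}.Nonempty := ⟨q - j, by
    rw [Set.mem_ofPred_eq, Nat.add_sub_cancel' hj]; exact hq⟩
  have h1 : 1 ≤ sInf {h | x (j + h) ≤ 0} := by
    by_contra hcon
    have h0 : sInf {h | x (j + h) ≤ 0} = 0 := by omega
    have := Nat.sInf_mem hne
    rw [h0, Set.mem_ofPred_eq, add_zero] at this
    linarith
  have h2 := Nat.sInf_add h1
  rw [plusRun, plusRun, ← h2]
  simp only [add_assoc, add_comm 1]

/-- The order properties of a real sequence `x 1, …, x q = 0` that hold for the orbit of the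
critical value when the critical point `0` of a unimodal map has period `q`. -/
structure CriticalOrder (q : ℕ) (x : ℕ → ℝ) : Prop where
  two_le : 2 ≤ q
  last : x q = 0
  ne_zero : ∀ j, 1 ≤ j → j < q → x j ≠ 0
  first_lt : ∀ j, 2 ≤ j → j ≤ q → x 1 < x j
  second_nonneg : 0 ≤ x 2
  inj : ∀ j k, 1 ≤ j → j ≤ q → 1 ≤ k → k ≤ q → x j = x k → j = k
  run_le : ∀ j, 1 ≤ j → j ≤ q → plusRun x j ≤ plusRun x 2

/-- A sequence of configurations `y m`, each the pullback of the previous one, together with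
tangent vectors `v m` transported by the derivative of the pullback. -/
structure PullbackOrbit (q : ℕ) (x ℓ : ℕ → ℝ) (y v : ℕ → ℕ → ℝ) : Prop where
  lt : ∀ m j k, 1 ≤ j → j ≤ q → 1 ≤ k → k ≤ q → x j < x k → y m j < y m k
  y_last : ∀ m, y m q = 0
  v_last : ∀ m, v m q = 0
  one_le : ∀ m, 1 ≤ -y m 1
  neg_le_two : ∀ m, -y m 1 ≤ 2
  le_two : ∀ m j, 1 ≤ j → j ≤ q → y m j ≤ 2
  y_rec : ∀ m j, 1 ≤ j → j < q → |y (m + 1) j| ^ ℓ j = y m (j + 1) - y m 1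
  v_rec : ∀ m j, 1 ≤ j → j < q →
    ℓ j * (v (m + 1) j / y (m + 1) j) = (v m (j + 1) - v m 1) / (y m (j + 1) - y m 1)

/-- The relative velocity of two points of a moving configuration. -/
noncomputable def relVel (y v : ℕ → ℕ → ℝ) (m j k : ℕ) : ℝ := (v m j - v m k) / (y m j - y m k)

theorem relVel_comm (y v : ℕ → ℕ → ℝ) (m j k : ℕ) : relVel y v m j k = relVel y v m k j := by
  rw [relVel, relVel, ← neg_sub (v m k), ← neg_sub (y m k), neg_div_neg_eq]

/-- All relative velocities at the level `m` are at most `g`. -/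
def VelBound (q : ℕ) (y v : ℕ → ℕ → ℝ) (m : ℕ) (g : ℝ) : Prop :=
  ∀ j k, 1 ≤ j → j ≤ q → 1 ≤ k → k ≤ q → |relVel y v m j k| ≤ g

/-- The exponent `ℓ` is large in terms of the other constants. -/
structure LargeExponent (κ ε R ℓ : ℝ) : Prop where
  one_le : 1 ≤ ℓ
  inv_le : 1 / ℓ ≤ ε / 2
  small : R * (1 - Real.exp (-(κ / ℓ))) ≤ 1 / 2
  four_lt : 4 < (1 + Real.exp (-κ)) ^ ℓ
  pow_le : (1 - Real.exp (-κ) / 2) ^ ℓ ≤ Real.exp (-κ)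

namespace CriticalOrder

variable {q : ℕ} {x : ℕ → ℝ}

theorem first_neg (C : CriticalOrder q x) : x 1 < 0 := by
  have := C.first_lt q C.two_le le_rfl
  rwa [C.last] at this

theorem lt_of_ne_zero (C : CriticalOrder q x) {j : ℕ} (hj : j ≤ q) (h : x j ≠ 0) : j < q :=
  lt_of_le_of_ne hj fun h' => h (h' ▸ C.last)

end CriticalOrder

namespace PullbackOrbit

variable {q : ℕ} {x ℓ : ℕ → ℝ} {y v : ℕ → ℕ → ℝ}

theorem neg_of (H : PullbackOrbit q x ℓ y v) (C : CriticalOrder q x) {m j : ℕ} (h1 : 1 ≤ j)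
    (hq : j ≤ q) (h : x j < 0) : y m j < 0 := by
  have := H.lt m j q h1 hq (by linarith [C.two_le]) le_rfl (by rwa [C.last])
  rwa [H.y_last] at this

theorem pos_of (H : PullbackOrbit q x ℓ y v) (C : CriticalOrder q x) {m j : ℕ} (h1 : 1 ≤ j)
    (hq : j ≤ q) (h : 0 < x j) : 0 < y m j := by
  have := H.lt m q j (by linarith [C.two_le]) le_rfl h1 hq (by rwa [C.last])
  rwa [H.y_last] at this

theorem neg_iff (H : PullbackOrbit q x ℓ y v) (C : CriticalOrder q x) {m j : ℕ} (h1 : 1 ≤ j)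
    (hq : j ≤ q) : y m j < 0 ↔ x j < 0 := by
  refine ⟨fun h => ?_, H.neg_of C h1 hq⟩
  rcases lt_trichotomy (x j) 0 with h' | h' | h'
  · exact h'
  · have : j = q := by
      by_contra hne
      exact C.ne_zero j h1 (lt_of_le_of_ne hq hne) h'
    rw [this, H.y_last] at h
    exact absurd h (lt_irrefl 0)
  · linarith [H.pos_of C (m := m) h1 hq h']

theorem pos_iff (H : PullbackOrbit q x ℓ y v) (C : CriticalOrder q x) {m j : ℕ} (h1 : 1 ≤ j)
    (hq : j ≤ q) : 0 < y m j ↔ 0 < x j := by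
  refine ⟨fun h => ?_, H.pos_of C h1 hq⟩
  rcases lt_trichotomy (x j) 0 with h' | h' | h'
  · linarith [H.neg_of C (m := m) h1 hq h']
  · have : j = q := by
      by_contra hne
      exact C.ne_zero j h1 (lt_of_le_of_ne hq hne) h'
    rw [this, H.y_last] at h
    exact absurd h (lt_irrefl 0)
  · exact h'

theorem ne_of_ne (H : PullbackOrbit q x ℓ y v) (C : CriticalOrder q x) {m j k : ℕ} (hj : 1 ≤ j)
    (hjq : j ≤ q) (hk : 1 ≤ k) (hkq : k ≤ q) (h : j ≠ k) : y m j ≠ y m k := by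
  rcases lt_trichotomy (x j) (x k) with h' | h' | h'
  · exact (H.lt m j k hj hjq hk hkq h').ne
  · exact absurd (C.inj j k hj hjq hk hkq h') h
  · exact (H.lt m k j hk hkq hj hjq h').ne'

theorem first_lt (H : PullbackOrbit q x ℓ y v) (C : CriticalOrder q x) {m j : ℕ} (h2 : 2 ≤ j)
    (hq : j ≤ q) : y m 1 < y m j :=
  H.lt m 1 j le_rfl (by linarith [C.two_le]) (by linarith) hq (C.first_lt j h2 hq)

theorem y_ne_zero (H : PullbackOrbit q x ℓ y v) (C : CriticalOrder q x) {m j : ℕ} (h1 : 1 ≤ j)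
    (hq : j < q) : y m j ≠ 0 := by
  have := H.ne_of_ne C (m := m) h1 hq.le (by linarith [C.two_le]) le_rfl hq.ne
  rwa [H.y_last] at this

theorem v_eq (H : PullbackOrbit q x ℓ y v) (C : CriticalOrder q x) {m j : ℕ} (h1 : 1 ≤ j)
    (hq : j ≤ q) : v m j = y m j * relVel y v m j q := by
  rw [relVel, H.y_last, H.v_last, sub_zero, sub_zero]
  rcases eq_or_lt_of_le hq with rfl | h
  · rw [H.v_last, H.y_last]; simp
  · have := H.y_ne_zero C (m := m) h1 h
    field_simp

theorem v_succ (H : PullbackOrbit q x ℓ y v) (C : CriticalOrder q x) {m j : ℕ} (h1 : 1 ≤ j)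
    (hq : j < q) (hℓ : 0 < ℓ j) : v (m + 1) j =
      y (m + 1) j * ((v m (j + 1) - v m 1) / |y (m + 1) j| ^ ℓ j / ℓ j) := by
  have h := H.v_rec m j h1 hq
  have hy := H.y_ne_zero C (m := m + 1) h1 hq
  rw [H.y_rec m j h1 hq, ← h]
  field_simp

theorem relVel_last (H : PullbackOrbit q x ℓ y v) {m j : ℕ} (h1 : 1 ≤ j) (hq : j < q)
    (hℓ : 0 < ℓ j) : relVel y v (m + 1) j q = relVel y v m (j + 1) 1 / ℓ j := by
  have h := H.v_rec m j h1 hq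
  rw [relVel, H.y_last, H.v_last, sub_zero, sub_zero, relVel, ← h]
  field_simp

/-- Across `0` the relative velocity is a weighted average of the velocities of the two points
relative to the critical point. -/
theorem relVel_of_nonpos_of_nonneg (H : PullbackOrbit q x ℓ y v) (C : CriticalOrder q x)
    {m j k : ℕ} {b : ℝ} (hj : 1 ≤ j) (hjq : j ≤ q) (hk : 1 ≤ k) (hkq : k ≤ q)
    (hyj : y m j ≤ 0) (hyk : 0 ≤ y m k)
    (hbj : |relVel y v m j q| ≤ b) (hbk : |relVel y v m k q| ≤ b) :
    |relVel y v m j k| ≤ b := by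
  have hb : 0 ≤ b := (abs_nonneg _).trans hbj
  rw [abs_le] at *
  rcases eq_or_lt_of_le (hyj.trans hyk) with h | h
  · rw [relVel, h, sub_self, div_zero]; constructor <;> linarith
  · rw [relVel, H.v_eq C hj hjq, H.v_eq C hk hkq, ← neg_div_neg_eq, neg_sub, neg_sub]
    have h0 : 0 < y m k - y m j := by linarith
    rw [le_div_iff₀ h0, div_le_iff₀ h0]
    constructor <;> nlinarith

/-- The relative velocity of two points on the same side of `0`. -/
theorem relVel_succ_le (H : PullbackOrbit q x ℓ y v) (C : CriticalOrder q x) {m j k : ℕ}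
    (hj : 1 ≤ j) (hjq : j < q) (hk : 1 ≤ k) (hkq : k < q) (hjk : x j < 0 ↔ x k < 0)
    (hℓ : ℓ j = ℓ k) (hℓ1 : 1 ≤ ℓ k) (hlt : y m (k + 1) < y m (j + 1)) :
    ∃ σ : ℝ, 0 ≤ σ ∧ σ ≤ 1 ∧ |relVel y v (m + 1) j k| ≤
        σ * (|relVel y v m (j + 1) (k + 1)| + |relVel y v m (k + 1) 1|) ∧
      ∀ κ : ℝ, 0 < κ → y m (k + 1) - y m 1 ≤ Real.exp (-κ) * (y m (j + 1) - y m 1) →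
        σ ≤ 1 / κ + 1 / ℓ k := by
  have hℓ0 : 0 < ℓ k := by linarith
  have hyj := H.y_ne_zero C (m := m + 1) hj hjq
  have hyk := H.y_ne_zero C (m := m + 1) hk hkq
  have hAj := H.y_rec m j hj hjq
  have hAk := H.y_rec m k hk hkq
  have hvj := H.v_succ C (m := m) hj hjq (by rw [hℓ]; exact hℓ0)
  have hvk := H.v_succ C (m := m) hk hkq hℓ0
  rw [hℓ] at hAj hvj
  have hj0 := abs_pos.2 hyj
  have hk0 := abs_pos.2 hyk
  have habs : |y (m + 1) k| < |y (m + 1) j| := by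
    rw [← Real.rpow_lt_rpow_iff hk0.le hj0.le hℓ0, hAj, hAk]
    linarith
  have hρ0 : 0 < |y (m + 1) k| / |y (m + 1) j| := by positivity
  have hρ1 : |y (m + 1) k| / |y (m + 1) j| < 1 := (div_lt_one hj0).2 habs
  have key := abs_root_diff_le (a := v m (j + 1) - v m 1) (b := v m (k + 1) - v m 1)
    hℓ1 hk0 habs
  have hL : (|y (m + 1) j| * ((v m (j + 1) - v m 1) / |y (m + 1) j| ^ ℓ k / ℓ k) -
      |y (m + 1) k| * ((v m (k + 1) - v m 1) / |y (m + 1) k| ^ ℓ k / ℓ k)) /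
        (|y (m + 1) j| - |y (m + 1) k|) = relVel y v (m + 1) j k := by
    rw [relVel, hvj, hvk]
    rcases lt_or_gt_of_ne hyk with h | h
    · have h' : y (m + 1) j < 0 := by
        rw [H.neg_iff C hj hjq.le, hjk, ← H.neg_iff C (m := m + 1) hk hkq.le]; exact h
      rw [← neg_div_neg_eq]
      simp only [abs_of_neg h, abs_of_neg h']
      congr 1 <;> ring
    · have h' : 0 < y (m + 1) j := by
        refine lt_of_le_of_ne (not_lt.1 ?_) hyj.symm
        rw [H.neg_iff C hj hjq.le, hjk, ← H.neg_iff C (m := m + 1) hk hkq.le]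
        exact h.not_gt
      simp only [abs_of_pos h, abs_of_pos h']
  rw [hL] at key
  refine ⟨_, ?_, rpow_quot_le_one hℓ1 hρ0 hρ1, ?_, fun κ hκ hle => ?_⟩
  · have : (|y (m + 1) k| / |y (m + 1) j|) ^ ℓ k ≤ 1 := Real.rpow_le_one hρ0.le hρ1.le hℓ0.le
    exact div_nonneg (by linarith) (mul_nonneg hℓ0.le (by linarith))
  · rw [hAj, hAk] at key
    convert key using 4
    · rw [relVel]; congr 1 <;> ring
    · rfl
  · refine rpow_quot_le_of_le_exp hℓ1 hρ0 hρ1 hκ ?_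
    rw [Real.div_rpow hk0.le hj0.le, hAj, hAk, div_le_iff₀]
    · exact hle
    · rw [← hAj]; positivity

end PullbackOrbit

/-! ### One pullback step with large exponents. -/

/-- A pullback orbit with large exponents whose relative velocities are at most `g` at all levels
below `M`. -/
structure ControlledOrbit (q : ℕ) (x ℓ : ℕ → ℝ) (κ ε R : ℝ) (y v : ℕ → ℕ → ℝ) (M : ℕ) (g : ℝ) :
    Prop where
  order : CriticalOrder q x
  orbit : PullbackOrbit q x ℓ y v
  large : ∀ j, LargeExponent κ ε R (ℓ j)
  same : ∀ j k, (x j < 0 ↔ x k < 0) → ℓ j = ℓ k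
  two_le : 2 ≤ κ
  inv_le : 1 / κ ≤ ε / 2
  pos : 0 < ε
  le_one : ε ≤ 1
  nonneg : 0 ≤ g
  bound : ∀ m < M, VelBound q y v m g

namespace ControlledOrbit

variable {q : ℕ} {x ℓ : ℕ → ℝ} {κ ε R : ℝ} {y v : ℕ → ℕ → ℝ} {M : ℕ} {g : ℝ}

theorem exp_le (K : ControlledOrbit q x ℓ κ ε R y v M g) : Real.exp (-κ) ≤ 1 / 3 := by
  have h1 := Real.add_one_le_exp κ
  have h2 := K.two_le
  rw [Real.exp_neg, ← one_div]
  exact one_div_le_one_div_of_le (by norm_num) (by linarith)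

theorem relVel_succ_last_le (K : ControlledOrbit q x ℓ κ ε R y v M g) {m j : ℕ} {b : ℝ}
    (h1 : 1 ≤ j) (hq : j < q) (hb : |relVel y v m (j + 1) 1| ≤ b) :
    |relVel y v (m + 1) j q| ≤ ε / 2 * b := by
  have hL := K.large j
  have hℓ : 0 < ℓ j := by linarith [hL.one_le]
  rw [K.orbit.relVel_last h1 hq hℓ, abs_div, abs_of_pos hℓ, div_eq_inv_mul, ← one_div]
  exact mul_le_mul hL.inv_le hb (abs_nonneg _) (by linarith [K.pos])

/-- Points with a long run of positive successors have small relative velocity with respect to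
the critical point. -/
theorem relVel_last_le_pow (K : ControlledOrbit q x ℓ κ ε R y v M g) (h : ℕ) :
    ∀ m, h ≤ m → m < M →
      (∀ j, 1 ≤ j → j ≤ q → h ≤ plusRun x j → |relVel y v m j q| ≤ (ε / 2) ^ h * g) ∧
      (h ≤ plusRun x 2 → |relVel y v m 1 q| ≤ (ε / 2) ^ h * g) := by
  have hq2 := K.order.two_le
  induction h with
  | zero =>
    intro m _ hM
    have hb := K.bound m hM
    simp only [pow_zero, one_mul]
    exact ⟨fun j h1 hq _ => hb j q h1 hq (by omega) le_rfl,
      fun _ => hb 1 q le_rfl (by omega) (by omega) le_rfl⟩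
  | succ h ih =>
    intro m hm hM
    obtain ⟨m, rfl⟩ : ∃ n, m = n + 1 := ⟨m - 1, by omega⟩
    obtain ⟨ihj, ih1⟩ := ih m (by omega) (by omega)
    have hb := K.bound m (by omega)
    -- One step gains `ε / 2`; the new pair `j + 1`, `1` straddles `0`, so both induction hypotheses
    -- apply. The critical value keeps up because its successor has the longest positive run.
    have main : ∀ j, 1 ≤ j → j < q → h ≤ plusRun x (j + 1) → h ≤ plusRun x 2 →
        |relVel y v (m + 1) j q| ≤ (ε / 2) ^ (h + 1) * g := by
      intro j h1 hjq hr h2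
      rw [pow_succ', mul_assoc]
      refine K.relVel_succ_last_le h1 hjq ?_
      rcases Nat.eq_zero_or_pos h with rfl | hpos
      · simpa using hb (j + 1) 1 (by omega) (by omega) le_rfl (by omega)
      rcases le_or_gt (x (j + 1)) 0 with hx | hx
      · have := plusRun_of_nonpos hx
        omega
      · rw [relVel_comm]
        refine K.orbit.relVel_of_nonpos_of_nonneg K.order le_rfl (by omega) (by omega) (by omega)
          (K.orbit.neg_of K.order le_rfl (by omega) K.order.first_neg).le
          (K.orbit.pos_of K.order (by omega) (by omega) hx).le (ih1 h2)
          (ihj (j + 1) (by omega) (by omega) hr)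
    refine ⟨fun j h1 hq hr => ?_, fun hr => main 1 le_rfl (by omega) (by simpa using by omega)
      (by omega)⟩
    have hx : 0 < x j := by
      by_contra hcon
      have := plusRun_of_nonpos (not_lt.1 hcon)
      omega
    have hs := plusRun_of_pos K.order.last.le hq hx
    have := K.order.run_le j h1 hq
    exact main j h1 (K.order.lt_of_ne_zero hq hx.ne') (by omega) (by omega)

theorem relVel_last_le (K : ControlledOrbit q x ℓ κ ε R y v M g) {m j : ℕ} (hm : 1 ≤ m)
    (hM : m < M) (h1 : 1 ≤ j) (hq : j ≤ q) : |relVel y v m j q| ≤ ε / 2 * g := by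
  obtain ⟨m, rfl⟩ : ∃ n, m = n + 1 := ⟨m - 1, by omega⟩
  rcases eq_or_lt_of_le hq with rfl | h
  · rw [relVel, sub_self, zero_div, abs_zero]
    exact mul_nonneg (by linarith [K.pos]) K.nonneg
  · exact K.relVel_succ_last_le h1 h (K.bound m (by omega) _ _ (by omega) (by omega) le_rfl
      (by omega))

theorem plusRun_le (K : ControlledOrbit q x ℓ κ ε R y v M g) {j : ℕ} (hj : j ≤ q) :
    plusRun x j ≤ q :=
  (Nat.sInf_le (by rw [Set.mem_ofPred_eq, Nat.add_sub_cancel' hj]; exact K.order.last.le)).trans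
    (Nat.sub_le q j)

theorem relVel_first_le_pow (K : ControlledOrbit q x ℓ κ ε R y v M g) {m j : ℕ} (hm : q ≤ m)
    (hM : m < M) (h1 : 1 ≤ j) (hq : j ≤ q) (hx : 0 < x j) :
    |relVel y v m j 1| ≤ (ε / 2) ^ plusRun x j * g := by
  have hq2 := K.order.two_le
  obtain ⟨h3, h4⟩ := K.relVel_last_le_pow (plusRun x j) m ((K.plusRun_le hq).trans hm) hM
  rw [relVel_comm]
  exact K.orbit.relVel_of_nonpos_of_nonneg K.order le_rfl (by omega) h1 hq
    (K.orbit.neg_of K.order le_rfl (by omega) K.order.first_neg).le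
    (K.orbit.pos_of K.order h1 hq hx).le (h4 (K.order.run_le j h1 hq)) (h3 j h1 hq le_rfl)

/-- Two points on the same side of `0`, with the successor of `j` above that of `k`. -/
theorem relVel_same_side_le (K : ControlledOrbit q x ℓ κ ε R y v M g) {m j k : ℕ}
    (hj : 1 ≤ j) (hjq : j < q) (hk : 1 ≤ k) (hkq : k < q) (hjk : x j < 0 ↔ x k < 0)
    (hlt : y m (k + 1) < y m (j + 1)) :
    |relVel y v (m + 1) j k| ≤ |relVel y v m (j + 1) (k + 1)| + |relVel y v m (k + 1) 1| ∧
      (y m (k + 1) - y m 1 ≤ Real.exp (-κ) * (y m (j + 1) - y m 1) →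
        |relVel y v (m + 1) j k| ≤
          ε * (|relVel y v m (j + 1) (k + 1)| + |relVel y v m (k + 1) 1|)) := by
  have hL := K.large k
  obtain ⟨σ, h0, h1, h2, h3⟩ := K.orbit.relVel_succ_le K.order hj hjq hk hkq hjk
    (K.same j k hjk) hL.one_le hlt
  have hs : 0 ≤ |relVel y v m (j + 1) (k + 1)| + |relVel y v m (k + 1) 1| := by positivity
  refine ⟨h2.trans (mul_le_of_le_one_left hs h1), fun hle => h2.trans ?_⟩
  have := h3 κ (by linarith [K.two_le]) hle
  exact mul_le_mul_of_nonneg_right (by linarith [hL.inv_le, K.inv_le]) hs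

theorem relVel_strong_le (K : ControlledOrbit q x ℓ κ ε R y v M g) {m j k : ℕ}
    (hj : 1 ≤ j) (hjq : j < q) (hk : 1 ≤ k) (hkq : k < q) (hjk : x j < 0 ↔ x k < 0)
    (hlt : y m (k + 1) < y m (j + 1)) (hM : m < M)
    (hs : y m (k + 1) - y m 1 ≤ Real.exp (-κ) * (y m (j + 1) - y m 1)) :
    |relVel y v (m + 1) j k| ≤ 2 * ε * g := by
  have h1 := (K.relVel_same_side_le hj hjq hk hkq hjk hlt).2 hs
  have h2 := K.bound m hM (j + 1) (k + 1) (by omega) (by omega) (by omega) (by omega)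
  have h3 := K.bound m hM (k + 1) 1 (by omega) (by omega) (by omega) (by omega)
  have := K.pos
  nlinarith

/-- A negative point far from the critical value has small relative velocity with respect to
the critical value. -/
theorem relVel_first_le_of_far (K : ControlledOrbit q x ℓ κ ε R y v M g) {m u : ℕ} (hm : 1 ≤ m)
    (hM : m < M) (hu : 2 ≤ u) (huq : u < q) (hx : x u < 0)
    (hfar : Real.exp (-κ) ≤ y m u - y m 1) : |relVel y v m u 1| ≤ 2 * ε * g := by
  obtain ⟨m, rfl⟩ : ∃ n, m = n + 1 := ⟨m - 1, by omega⟩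
  have H := K.orbit
  have hx1 := K.order.first_neg
  have hL := K.large 1
  have hℓ0 : 0 < ℓ 1 := by linarith [hL.one_le]
  have he := Real.exp_pos (-κ)
  have he3 := K.exp_le
  have huu := H.y_rec m u (by omega) huq
  have h11 := H.y_rec m 1 le_rfl (by omega)
  rw [K.same u 1 (by simp [hx, hx1])] at huu
  have hyu : y (m + 1) u < 0 := H.neg_of K.order (by omega) huq.le hx
  have hy1 : y (m + 1) 1 < 0 := H.neg_of K.order (by omega) (by omega) hx1
  rw [abs_of_neg hyu] at huu
  rw [abs_of_neg hy1] at h11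
  have ha := H.one_le m
  have ha2 := H.neg_le_two m
  have hy2 : y m (1 + 1) ≤ 2 := H.le_two m 2 (by omega) (by omega)
  -- The `ℓ`-th power of the left side is `y m 2 - y m 1 ≤ 4`, so `four_lt` applies. By `hfar` the
  -- point `u` then has distance less than `1` to `0`, and its successor is negative.
  have h1lt : -y (m + 1) 1 < 1 + Real.exp (-κ) := by
    by_contra hcon
    have := Real.rpow_le_rpow (by linarith) (not_lt.1 hcon) hℓ0.le
    linarith [hL.four_lt]
  have hu1 : y m (u + 1) < 0 := by
    by_contra hcon
    have h1 : -y (m + 1) u < 1 := by linarith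
    have := Real.rpow_lt_one (by linarith) h1 hℓ0
    linarith
  have h2pos : 0 ≤ y m (1 + 1) := by
    rw [← not_lt, H.neg_iff K.order (by omega) (by omega), not_lt]
    exact K.order.second_nonneg
  -- A gap of at least `exp (-κ)` in a length of at most `2`; `pow_le` turns this ratio into strong
  -- separation of the successors.
  have hratio : -y (m + 1) u ≤ (1 - Real.exp (-κ) / 2) * -y (m + 1) 1 := by
    have := H.neg_le_two (m + 1)
    nlinarith
  have hpow := Real.rpow_le_rpow (by linarith) hratio hℓ0.le
  rw [Real.mul_rpow (by linarith) (by linarith), huu, h11] at hpow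
  rw [relVel_comm]
  refine K.relVel_strong_le le_rfl (by omega) (by omega) huq (by simp [hx, hx1])
    (by linarith) (by omega) (hpow.trans ?_)
  exact mul_le_mul_of_nonneg_right hL.pow_le (by linarith)

/-- What the successors of two points on the same side of `0` can look like. -/
theorem relVel_cases_of_lt (K : ControlledOrbit q x ℓ κ ε R y v M g) {m j k : ℕ}
    (hm : q ≤ m) (hM : m < M) (hj : 1 ≤ j) (hjq : j < q) (hk : 1 ≤ k) (hkq : k < q)
    (hjk : x j < 0 ↔ x k < 0) (hlt : y m (k + 1) < y m (j + 1)) :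
    |relVel y v (m + 1) j k| ≤ 3 * ε * g ∨
      (y m (j + 1) - y m 1 ≤ Real.exp κ * (y m (k + 1) - y m 1) ∧
        ((0 < x (j + 1) ∧ 0 < x (k + 1) ∧ |relVel y v (m + 1) j k| ≤
          |relVel y v m (j + 1) (k + 1)| + (ε / 2) ^ plusRun x (k + 1) * g) ∨
        (x (j + 1) < 0 ∧ x (k + 1) < 0 ∧ |relVel y v (m + 1) j k| ≤
          |relVel y v m (j + 1) (k + 1)| + |relVel y v m 1 (k + 1)|))) := by
  have H := K.orbit
  have hg := K.nonneg
  have hε := K.pos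
  have hεg : 0 ≤ ε * g := mul_nonneg hε.le hg
  have ha := H.one_le m
  have hq2 := K.order.two_le
  by_cases hs : y m (k + 1) - y m 1 ≤ Real.exp (-κ) * (y m (j + 1) - y m 1)
  · left
    have := K.relVel_strong_le hj hjq hk hkq hjk hlt hM hs
    linarith
  have hle := (K.relVel_same_side_le hj hjq hk hkq hjk hlt).1
  rw [not_le] at hs
  have hratio : y m (j + 1) - y m 1 ≤ Real.exp κ * (y m (k + 1) - y m 1) := by
    have h1 := mul_lt_mul_of_pos_left hs (Real.exp_pos κ)
    rw [← mul_assoc, ← Real.exp_add, add_neg_cancel, Real.exp_zero, one_mul] at h1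
    exact h1.le
  have hjl := K.relVel_last_le (m := m) (by omega) hM (j := j + 1) (by omega) (by omega)
  have hkl := K.relVel_last_le (m := m) (by omega) hM (j := k + 1) (by omega) (by omega)
  have h1l := K.relVel_last_le (m := m) (by omega) hM (j := 1) (by omega) (by omega)
  rcases eq_or_lt_of_le (show k + 1 ≤ q by omega) with hkq' | hkq'
  · left
    rw [hkq', relVel_comm y v m q 1] at hle
    linarith
  have hk0 := K.order.ne_zero (k + 1) (by omega) hkq'
  rcases lt_or_gt_of_ne hk0 with hxk | hxk
  · rcases lt_or_ge (x (j + 1)) 0 with hxj | hxj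
    · right
      rw [relVel_comm y v m (k + 1) 1] at hle
      exact ⟨hratio, Or.inr ⟨hxj, hxk, hle⟩⟩
    · left
      have hyj : 0 ≤ y m (j + 1) := by
        rw [← not_lt, H.neg_iff K.order (by omega) (by omega), not_lt]; exact hxj
      have h1 := H.relVel_of_nonpos_of_nonneg K.order (by omega) hkq'.le (by omega) (by omega)
        (H.neg_of K.order (by omega) hkq'.le hxk).le hyj hkl hjl
      rw [relVel_comm] at h1
      -- Since `y m (j + 1) ≥ 0` is at distance at least `1` from the critical value, the failure of
      -- separation keeps `k + 1` at distance at least `exp (-κ)` from it.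
      have h2 := K.relVel_first_le_of_far (m := m) (by omega) hM (u := k + 1) (by omega) hkq' hxk
        (by nlinarith [Real.exp_pos (-κ)])
      linarith
  · right
    have hyk : 0 < y m (k + 1) := H.pos_of K.order (by omega) hkq'.le hxk
    refine ⟨hratio, Or.inl ⟨?_, hxk, ?_⟩⟩
    · rw [← H.pos_iff K.order (m := m) (by omega) (by omega)]; linarith
    · have := K.relVel_first_le_pow hm hM (by omega) hkq'.le hxk
      linarith

theorem relVel_cases (K : ControlledOrbit q x ℓ κ ε R y v M g) {m j k : ℕ}
    (hm : q ≤ m) (hM : m < M) (hj : 1 ≤ j) (hjq : j < q) (hk : 1 ≤ k) (hkq : k < q)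
    (hne : j ≠ k) (hjk : x j < 0 ↔ x k < 0) :
    |relVel y v (m + 1) j k| ≤ 3 * ε * g ∨
      (y m (j + 1) - y m 1 ≤ Real.exp κ * (y m (k + 1) - y m 1) ∧
        y m (k + 1) - y m 1 ≤ Real.exp κ * (y m (j + 1) - y m 1) ∧
        ((0 < x (j + 1) ∧ 0 < x (k + 1) ∧ |relVel y v (m + 1) j k| ≤
          |relVel y v m (j + 1) (k + 1)| +
            (ε / 2) ^ min (plusRun x (j + 1)) (plusRun x (k + 1)) * g) ∨
        (x (j + 1) < 0 ∧ x (k + 1) < 0 ∧ ∃ u, (u = j + 1 ∨ u = k + 1) ∧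
          y m u = min (y m (j + 1)) (y m (k + 1)) ∧ |relVel y v (m + 1) j k| ≤
          |relVel y v m (j + 1) (k + 1)| + |relVel y v m 1 u|))) := by
  have H := K.orbit
  have hg := K.nonneg
  have hε := K.pos
  have hε1 := K.le_one
  have hexp : 1 ≤ Real.exp κ := Real.one_le_exp (by linarith [K.two_le])
  have mono : ∀ a b : ℕ, (ε / 2) ^ a * g ≤ (ε / 2) ^ min a b * g := fun a b =>
    mul_le_mul_of_nonneg_right
      (pow_le_pow_of_le_one (by linarith) (by linarith) (min_le_left a b)) hg
  have hj1 := H.first_lt K.order (m := m) (j := j + 1) (by omega) (by omega)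
  have hk1 := H.first_lt K.order (m := m) (j := k + 1) (by omega) (by omega)
  rcases lt_or_gt_of_ne (H.ne_of_ne K.order (m := m) (j := j + 1) (k := k + 1) (by omega)
    (by omega) (by omega) (by omega) (by omega)) with hlt | hlt
  · rcases K.relVel_cases_of_lt hm hM hk hkq hj hjq hjk.symm hlt with h | ⟨hr, h⟩
    · rw [relVel_comm]; exact Or.inl h
    · rw [relVel_comm y v (m + 1) k j, relVel_comm y v m (k + 1) (j + 1)] at h
      refine Or.inr ⟨by nlinarith, hr, ?_⟩
      rcases h with ⟨h1, h2, h3⟩ | ⟨h1, h2, h3⟩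
      · exact Or.inl ⟨h2, h1, by linarith [mono (plusRun x (j + 1)) (plusRun x (k + 1))]⟩
      · exact Or.inr ⟨h2, h1, j + 1, Or.inl rfl, (min_eq_left hlt.le).symm, h3⟩
  · rcases K.relVel_cases_of_lt hm hM hj hjq hk hkq hjk hlt with h | ⟨hr, h⟩
    · exact Or.inl h
    · refine Or.inr ⟨hr, by nlinarith, ?_⟩
      rcases h with ⟨h1, h2, h3⟩ | ⟨h1, h2, h3⟩
      · refine Or.inl ⟨h1, h2, ?_⟩
        rw [min_comm]
        linarith [mono (plusRun x (k + 1)) (plusRun x (j + 1))]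
      · exact Or.inr ⟨h1, h2, k + 1, Or.inr rfl, (min_eq_right hlt.le).symm, h3⟩

end ControlledOrbit

/-! ### Contraction by counting negative entries of the shadowing orbit. -/

/-- The number of negative entries of `x` with index in `[t, q)`. -/
noncomputable def negCount (q : ℕ) (x : ℕ → ℝ) (t : ℕ) : ℕ :=
  ((Finset.Ico t q).filter (fun j => x j < 0)).card

theorem negCount_succ_le (q : ℕ) (x : ℕ → ℝ) (t : ℕ) : negCount q x (t + 1) ≤ negCount q x t :=
  Finset.card_le_card (Finset.filter_subset_filter _ (Finset.Ico_subset_Ico_left (Nat.le_succ t)))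

theorem negCount_of_neg {q : ℕ} {x : ℕ → ℝ} {t : ℕ} (ht : t < q) (hx : x t < 0) :
    negCount q x t = negCount q x (t + 1) + 1 := by
  rw [negCount, negCount, ← Finset.insert_Ico_add_one_left_eq_Ico ht, Finset.filter_insert,
    if_pos hx, Finset.card_insert_of_notMem (by simp)]

theorem le_iterate_shadowGrowth {κ R : ℝ} (hκ : 0 ≤ κ) (hR : 1 ≤ R) (n : ℕ) :
    R ≤ (shadowGrowth κ)^[n] R := by
  induction n with
  | zero => simp
  | succ n ih =>
    rw [Function.iterate_succ_apply']
    exact ih.trans (le_shadowGrowth hκ (by linarith))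

/-- The factor in the contraction estimate for orbits with `e` further negative points. -/
def contractionFactor : ℕ → ℝ
  | 0 => 3
  | e + 1 => 2 * contractionFactor e + 2

theorem three_le_contractionFactor (e : ℕ) : 3 ≤ contractionFactor e := by
  induction e with
  | zero => simp [contractionFactor]
  | succ e ih => rw [contractionFactor]; linarith

namespace ControlledOrbit

variable {q : ℕ} {x ℓ : ℕ → ℝ} {κ ε R : ℝ} {y v : ℕ → ℕ → ℝ} {M : ℕ} {g : ℝ}

/-- Here `s` is the sign of the pair, so that `s * y` is the distance to `0`. Shadowing a pair with
comparable successors makes `s * y (m + 1) t` strictly positive: `t` is on the side of the pair and,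
as `y (m + 1) q = 0`, differs from `q`. -/
theorem shadow_powers (K : ControlledOrbit q x ℓ κ ε R y v M g) {m j k t : ℕ} {s R₀ : ℝ}
    (hs : s = 1 ∨ s = -1) (hR₀ : 1 ≤ R₀) (hR : R₀ ≤ R)
    (hj : 1 ≤ j) (hjq : j < q) (hk : 1 ≤ k) (hkq : k < q) (ht : 1 ≤ t) (htq : t ≤ q)
    (hjk : x j < 0 ↔ x k < 0)
    (hS : Shadows R₀ (s * y (m + 1) j) (s * y (m + 1) k) (s * y (m + 1) t))
    (hr : y m (j + 1) - y m 1 ≤ Real.exp κ * (y m (k + 1) - y m 1)) :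
    t < q ∧ (x t < 0 ↔ x j < 0) ∧
      R₀ * (1 - Real.exp (-(κ / ℓ j))) ≤ 1 / 2 ∧
      (s * y (m + 1) j) ^ ℓ j = y m (j + 1) + -y m 1 ∧
      (s * y (m + 1) k) ^ ℓ j = y m (k + 1) + -y m 1 ∧
      (s * y (m + 1) t) ^ ℓ j = y m (t + 1) + -y m 1 := by
  have H := K.orbit
  have hL := K.large j
  have habs : ∀ {i : ℕ}, 0 < s * y (m + 1) i → |y (m + 1) i| = s * y (m + 1) i := by
    intro i hi
    rw [← abs_of_pos hi, abs_mul]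
    rcases hs with rfl | rfl <;> simp
  have hℓ0 : 0 < ℓ j := by linarith [hL.one_le]
  have hκ : 0 ≤ κ / ℓ j := div_nonneg (by linarith [K.two_le]) hℓ0.le
  have hsmall : R₀ * (1 - Real.exp (-(κ / ℓ j))) ≤ 1 / 2 := by
    have h1 : Real.exp (-(κ / ℓ j)) ≤ 1 := Real.exp_le_one_iff.2 (by linarith)
    exact (mul_le_mul_of_nonneg_right hR (by linarith)).trans hL.small
  obtain ⟨hj0, hk0⟩ := hS.pos
  have hpj := H.y_rec m j hj hjq
  have hpk := H.y_rec m k hk hkq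
  rw [habs hj0] at hpj
  rw [habs hk0, K.same k j hjk.symm] at hpk
  have ht0 := (hS.pow hR₀ hL.one_le hsmall (by rw [hpj, hpk]; exact hr)).1
  have htq' : t < q := by
    refine lt_of_le_of_ne htq fun h => ?_
    rw [h, H.y_last, mul_zero] at ht0
    exact lt_irrefl 0 ht0
  have hsign : x t < 0 ↔ x j < 0 := by
    rw [← H.neg_iff K.order (m := m + 1) ht htq, ← H.neg_iff K.order (m := m + 1) hj hjq.le]
    rcases hs with rfl | rfl
    · constructor <;> intro <;> linarith
    · constructor <;> intro <;> linarith
  have hpt := H.y_rec m t ht htq'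
  rw [habs ht0, K.same t j hsign] at hpt
  exact ⟨htq', hsign, hsmall, hpj, hpk, hpt⟩

/-- The contraction estimate for pairs of negative points, with `e` bounding the number of later
negative points of the shadowing orbit. -/
def NegEstimate (_ : ControlledOrbit q x ℓ κ ε R y v M g) (e : ℕ) : Prop :=
  ∀ m j k t R₀, (e + 1) * (q + 2) ≤ m → m ≤ M → 1 ≤ j → j < q → 1 ≤ k → k < q → j ≠ k →
    x j < 0 → x k < 0 → 1 ≤ t → t ≤ q → negCount q x t ≤ e → 1 ≤ R₀ →
    (shadowGrowth κ)^[e] R₀ ≤ R → Shadows R₀ (-1 * y m j) (-1 * y m k) (-1 * y m t) →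
    |relVel y v m j k| ≤ contractionFactor e * ε * g

/-- The contraction estimate for pairs of positive points. -/
def PosEstimate (_ : ControlledOrbit q x ℓ κ ε R y v M g) (e : ℕ) : Prop :=
  ∀ m j k t R₀, (e + 1) * (q + 2) + 1 + (q - j) ≤ m → m ≤ M → 1 ≤ j → j < q → 1 ≤ k → k < q →
    j ≠ k → 0 < x j → 0 < x k → 1 ≤ t → t ≤ q → negCount q x t ≤ e → 1 ≤ R₀ →
    (shadowGrowth κ)^[e + 1] R₀ ≤ R → Shadows R₀ (1 * y m j) (1 * y m k) (1 * y m t) →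
    |relVel y v m j k| ≤ contractionFactor (e + 1) * ε * g -
      4 * g * (ε / 2) ^ min (plusRun x j) (plusRun x k)

/-- Passing to the successors of a pair both of whose successors are negative. -/
theorem relVel_le_of_neg (K : ControlledOrbit q x ℓ κ ε R y v M g) {e m j k t u : ℕ} {s R₀ : ℝ}
    (hN : K.NegEstimate e) (hm : (e + 1) * (q + 2) ≤ m) (hM : m < M)
    (hs : s = 1 ∨ s = -1) (hR₀ : 1 ≤ R₀) (hR : (shadowGrowth κ)^[e + 1] R₀ ≤ R)
    (hj : 1 ≤ j) (hjq : j < q) (hk : 1 ≤ k) (hkq : k < q) (ht : 1 ≤ t) (htq : t ≤ q)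
    (hne : j ≠ k) (hjk : x j < 0 ↔ x k < 0) (hcount : negCount q x (t + 1) ≤ e)
    (hS : Shadows R₀ (s * y (m + 1) j) (s * y (m + 1) k) (s * y (m + 1) t))
    (hr : y m (j + 1) - y m 1 ≤ Real.exp κ * (y m (k + 1) - y m 1))
    (hr' : y m (k + 1) - y m 1 ≤ Real.exp κ * (y m (j + 1) - y m 1))
    (hxj : x (j + 1) < 0) (hxk : x (k + 1) < 0) (hu : u = j + 1 ∨ u = k + 1)
    (hyu : y m u = min (y m (j + 1)) (y m (k + 1)))
    (hle : |relVel y v (m + 1) j k| ≤ |relVel y v m (j + 1) (k + 1)| + |relVel y v m 1 u|) :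
    |relVel y v (m + 1) j k| ≤ 2 * contractionFactor e * ε * g := by
  have hκ : 0 ≤ κ := by linarith [K.two_le]
  have H := K.orbit
  obtain ⟨htq', hsign, hsmall, hpj, hpk, hpt⟩ := K.shadow_powers hs hR₀
    ((le_iterate_shadowGrowth hκ hR₀ _).trans hR) hj hjq hk hkq ht htq hjk hS hr
  have hjq' := K.order.lt_of_ne_zero (show j + 1 ≤ q by omega) hxj.ne
  have hkq' := K.order.lt_of_ne_zero (show k + 1 ≤ q by omega) hxk.ne
  have hyj := H.neg_of K.order (m := m) (by omega) hjq'.le hxj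
  have hyk := H.neg_of K.order (m := m) (by omega) hkq'.le hxk
  obtain ⟨h1, h2⟩ := hS.image_neg hR₀ hκ (K.large j).one_le hsmall
    (by rw [hpj, hpk]; exact hr) (by rw [hpj, hpk]; exact hr') hyj hyk hpj hpk hpt
  rw [← hyu] at h2
  have hgrow : (shadowGrowth κ)^[e] (shadowGrowth κ R₀) ≤ R := hR
  have hS1 : 1 ≤ shadowGrowth κ R₀ := hR₀.trans (le_shadowGrowth hκ (by linarith))
  have hxu : x u < 0 := by rcases hu with rfl | rfl <;> assumption
  have huq : u < q := by rcases hu with rfl | rfl <;> assumption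
  -- Two negative pairs, both shadowed by `t + 1`; hence the factor `2`.
  have e1 := hN m (j + 1) (k + 1) (t + 1) _ hm hM.le (by omega) hjq' (by omega) hkq' (by omega)
    hxj hxk (by omega) (by omega) hcount hS1 hgrow (by simpa only [neg_one_mul] using h1)
  have e2 := hN m 1 u (t + 1) _ hm hM.le le_rfl (by omega) (by omega) huq (by omega)
    K.order.first_neg hxu (by omega) (by omega) hcount hS1 hgrow
    (by simpa only [neg_one_mul] using h2)
  linarith

/-- The term subtracted in `PosEstimate` absorbs the error `(ε / 2) ^ h * g` of each step, so a
positive run of any length costs only the `2 * ε * g` contained in `contractionFactor (e + 1)`. The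
induction is on `q - j`. -/
theorem posEstimate (K : ControlledOrbit q x ℓ κ ε R y v M g) {e : ℕ} (hN : K.NegEstimate e) :
    K.PosEstimate e := by
  have hκ : 0 ≤ κ := by linarith [K.two_le]
  have hg := K.nonneg
  have hε := K.pos
  have hε1 := K.le_one
  have hεg : 0 ≤ ε * g := mul_nonneg hε.le hg
  have hc := three_le_contractionFactor e
  have hcg : 3 * (ε * g) ≤ contractionFactor e * (ε * g) := mul_le_mul_of_nonneg_right hc hεg
  have H := K.orbit
  suffices ∀ n m j k t R₀, q - j ≤ n → (e + 1) * (q + 2) + 1 + (q - j) ≤ m → m ≤ M → 1 ≤ j →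
      j < q → 1 ≤ k → k < q → j ≠ k → 0 < x j → 0 < x k → 1 ≤ t → t ≤ q → negCount q x t ≤ e →
      1 ≤ R₀ → (shadowGrowth κ)^[e + 1] R₀ ≤ R →
      Shadows R₀ (1 * y m j) (1 * y m k) (1 * y m t) →
      |relVel y v m j k| ≤ contractionFactor (e + 1) * ε * g -
        4 * g * (ε / 2) ^ min (plusRun x j) (plusRun x k) from
    fun m j k t R₀ => this (q - j) m j k t R₀ le_rfl
  intro n
  induction n with
  | zero => intro m j k t R₀ hn; omega
  | succ n ih =>
    intro m j k t R₀ hn hm hM hj hjq hk hkq hne hxj hxk ht htq hcount hR₀ hR hS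
    obtain ⟨m, rfl⟩ : ∃ i, m = i + 1 := ⟨m - 1, by omega⟩
    have hqm : q ≤ m := by nlinarith
    have hjk : x j < 0 ↔ x k < 0 := by constructor <;> intro <;> linarith
    have hrj := plusRun_of_pos K.order.last.le hjq.le hxj
    have hrk := plusRun_of_pos K.order.last.le hkq.le hxk
    have hmin : min (plusRun x j) (plusRun x k) =
        min (plusRun x (j + 1)) (plusRun x (k + 1)) + 1 := by omega
    rw [hmin]
    set h := min (plusRun x (j + 1)) (plusRun x (k + 1))
    have hpow0 : 0 ≤ (ε / 2) ^ h := by positivity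
    have hpow1 : (ε / 2) ^ h ≤ 1 := pow_le_one₀ (by linarith) (by linarith)
    have hgp0 : 0 ≤ g * (ε / 2) ^ h := mul_nonneg hg hpow0
    have hgp1 : 4 * g * (ε / 2) ^ (h + 1) ≤ 2 * (ε * g) := by
      rw [pow_succ]; nlinarith
    have hgp2 : 4 * g * (ε / 2) ^ (h + 1) ≤ 2 * (g * (ε / 2) ^ h) := by
      rw [pow_succ]; nlinarith
    have hd : contractionFactor (e + 1) = 2 * contractionFactor e + 2 := rfl
    have hcount' := (negCount_succ_le q x t).trans hcount
    rcases K.relVel_cases hqm (by omega) hj hjq hk hkq hne hjk with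
      h1 | ⟨hr, hr', ⟨hxj', hxk', h1⟩ | ⟨hxj', hxk', u, hu, hyu, h1⟩⟩
    · rw [hd]; linarith
    · obtain ⟨htq', hsign, hsmall, hpj, hpk, hpt⟩ := K.shadow_powers (Or.inl rfl) hR₀
        ((le_iterate_shadowGrowth hκ hR₀ _).trans hR) hj hjq hk hkq ht htq hjk hS hr
      have hjq' := K.order.lt_of_ne_zero (show j + 1 ≤ q by omega) hxj'.ne'
      have hkq' := K.order.lt_of_ne_zero (show k + 1 ≤ q by omega) hxk'.ne'
      have hS' := hS.image_pos hR₀ (K.large j).one_le hsmall (by rw [hpj, hpk]; exact hr)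
        (by linarith [H.one_le m]) (H.pos_of K.order (by omega) hjq'.le hxj')
        (H.pos_of K.order (by omega) hkq'.le hxk') hpj hpk hpt
      have := ih m (j + 1) (k + 1) (t + 1) R₀ (by omega) (by omega) (by omega) (by omega) hjq'
        (by omega) hkq' (by omega) hxj' hxk' (by omega) (by omega) hcount' hR₀ hR
        (by simpa only [one_mul] using hS')
      linarith
    · have := K.relVel_le_of_neg hN (by omega) (by omega) (Or.inl rfl) hR₀ hR hj hjq hk hkq ht htq
        hne hjk hcount' hS hr hr' hxj' hxk' hu hyu h1
      rw [hd]; linarith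

/-- Induction on the negative entries left for `t`. Without separation `t < q` is itself one of
them: this is absurd for `e = 0`, and otherwise `t + 1` has one fewer. -/
theorem negEstimate (K : ControlledOrbit q x ℓ κ ε R y v M g) (e : ℕ) : K.NegEstimate e := by
  have hκ : 0 ≤ κ := by linarith [K.two_le]
  have hg := K.nonneg
  have hε := K.pos
  have hε1 := K.le_one
  have hεg : 0 ≤ ε * g := mul_nonneg hε.le hg
  have H := K.orbit
  induction e with
  | zero =>
    intro m j k t R₀ hm hM hj hjq hk hkq hne hxj hxk ht htq hcount hR₀ hR hS
    obtain ⟨m, rfl⟩ : ∃ i, m = i + 1 := ⟨m - 1, by omega⟩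
    have hjk : x j < 0 ↔ x k < 0 := by simp [hxj, hxk]
    rcases K.relVel_cases (m := m) (by omega) (by omega) hj hjq hk hkq hne hjk with h1 | ⟨hr, -, -⟩
    · exact h1
    · obtain ⟨htq', hsign, -⟩ := K.shadow_powers (Or.inr rfl) hR₀
        ((le_iterate_shadowGrowth hκ hR₀ _).trans hR) hj hjq hk hkq ht htq hjk hS hr
      have := negCount_of_neg htq' (hsign.2 hxj)
      omega
  | succ e ih =>
    intro m j k t R₀ hm hM hj hjq hk hkq hne hxj hxk ht htq hcount hR₀ hR hS
    obtain ⟨m, rfl⟩ : ∃ i, m = i + 1 := ⟨m - 1, by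
      have : 0 < (e + 1 + 1) * (q + 2) := by positivity
      omega⟩
    -- Of the `q + 2` extra levels one is spent here; the rest cover a positive run that may follow.
    have hm' : (e + 1) * (q + 2) + (q + 1) ≤ m := by
      have : (e + 1 + 1) * (q + 2) = (e + 1) * (q + 2) + (q + 2) := by ring
      omega
    have hjk : x j < 0 ↔ x k < 0 := by simp [hxj, hxk]
    have hc := three_le_contractionFactor e
    have hcg : 3 * (ε * g) ≤ contractionFactor e * (ε * g) := mul_le_mul_of_nonneg_right hc hεg
    have hd : contractionFactor (e + 1) = 2 * contractionFactor e + 2 := rfl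
    rcases K.relVel_cases (m := m) (by omega) (by omega) hj hjq hk hkq hne hjk with
      h1 | ⟨hr, hr', h⟩
    · rw [hd]; linarith
    · obtain ⟨htq', hsign, hsmall, hpj, hpk, hpt⟩ := K.shadow_powers (Or.inr rfl) hR₀
        ((le_iterate_shadowGrowth hκ hR₀ _).trans hR) hj hjq hk hkq ht htq hjk hS hr
      have hcount' : negCount q x (t + 1) ≤ e := by
        have := negCount_of_neg htq' (hsign.2 hxj)
        omega
      rcases h with ⟨hxj', hxk', h1⟩ | ⟨hxj', hxk', u, hu, hyu, h1⟩
      · have hjq' := K.order.lt_of_ne_zero (show j + 1 ≤ q by omega) hxj'.ne'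
        have hkq' := K.order.lt_of_ne_zero (show k + 1 ≤ q by omega) hxk'.ne'
        have hS' := hS.image_pos hR₀ (K.large j).one_le hsmall (by rw [hpj, hpk]; exact hr)
          (by linarith [H.one_le m]) (H.pos_of K.order (by omega) hjq'.le hxj')
          (H.pos_of K.order (by omega) hkq'.le hxk') hpj hpk hpt
        have := K.posEstimate ih m (j + 1) (k + 1) (t + 1) R₀ (by omega) (by omega) (by omega) hjq'
          (by omega) hkq' (by omega) hxj' hxk' (by omega) (by omega) hcount' hR₀ hR
          (by simpa only [one_mul] using hS')
        have h0 : 0 ≤ g * (ε / 2) ^ min (plusRun x (j + 1)) (plusRun x (k + 1)) := by positivity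
        linarith
      · have := K.relVel_le_of_neg ih (by omega) (by omega) (Or.inr rfl) hR₀ hR hj hjq hk hkq ht
          htq hne hjk hcount' hS hr hr' hxj' hxk' hu hyu h1
        rw [hd]; linarith

/-- Pulling back contracts relative velocities. -/
theorem velBound_half (K : ControlledOrbit q x ℓ κ ε R y v M g) {e : ℕ}
    (he : negCount q x 1 ≤ e) (hR : (shadowGrowth κ)^[e + 1] 1 ≤ R)
    (hε : contractionFactor (e + 1) * ε ≤ 1 / 2) (hM : (e + 2) * (q + 2) ≤ M) :
    VelBound q y v M (g / 2) := by
  have hκ : 0 ≤ κ := by linarith [K.two_le]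
  have hg := K.nonneg
  have hε0 := K.pos
  have hεg : 0 ≤ ε * g := mul_nonneg hε0.le hg
  have hc := three_le_contractionFactor e
  have H := K.orbit
  have hd : contractionFactor (e + 1) = 2 * contractionFactor e + 2 := rfl
  have hge : contractionFactor (e + 1) * ε * g ≤ g / 2 := by
    have := mul_le_mul_of_nonneg_right hε hg
    linarith
  have hcg : 3 * (ε * g) ≤ contractionFactor e * (ε * g) := mul_le_mul_of_nonneg_right hc hεg
  have hεhalf : ε / 2 * g ≤ g / 2 := by rw [hd] at hge; linarith
  have hce : contractionFactor e * ε * g ≤ g / 2 := by rw [hd] at hge; linarith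
  have hM2 : (e + 1) * (q + 2) + (q + 2) ≤ M := by
    have : (e + 2) * (q + 2) = (e + 1) * (q + 2) + (q + 2) := by ring
    omega
  have hlast : ∀ j, 1 ≤ j → j ≤ q → |relVel y v M j q| ≤ g / 2 := by
    intro j hj hjq
    obtain ⟨N, rfl⟩ : ∃ i, M = i + 1 := ⟨M - 1, by omega⟩
    rcases eq_or_lt_of_le hjq with rfl | h
    · rw [relVel, sub_self, zero_div, abs_zero]; linarith
    · exact (K.relVel_succ_last_le hj h (K.bound N (by omega) _ _ (by omega) (by omega) le_rfl
        (by omega))).trans hεhalf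
  have hcount : ∀ j, 1 ≤ j → negCount q x j ≤ e := fun j hj =>
    (Finset.card_le_card
      (Finset.filter_subset_filter _ (Finset.Ico_subset_Ico_left hj))).trans he
  intro j k hj hjq hk hkq
  have hopp : ∀ j k, 1 ≤ j → j ≤ q → 1 ≤ k → k ≤ q → y M j ≤ 0 → 0 ≤ y M k →
      |relVel y v M j k| ≤ g / 2 := fun j k hj hjq hk hkq h1 h2 =>
    H.relVel_of_nonpos_of_nonneg K.order hj hjq hk hkq h1 h2 (hlast j hj hjq) (hlast k hk hkq)
  by_cases hne : j = k
  · rw [hne, relVel, sub_self, zero_div, abs_zero]; linarith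
  rcases lt_or_ge (y M j) 0 with h1 | h1 <;> rcases lt_or_ge (y M k) 0 with h2 | h2
  · have hxj := (H.neg_iff K.order hj hjq).1 h1
    have hxk := (H.neg_iff K.order hk hkq).1 h2
    -- At the start `j` shadows its own pair, with constant `1`.
    have := K.negEstimate e M j k j 1 (by omega) le_rfl hj (K.order.lt_of_ne_zero hjq hxj.ne)
      hk (K.order.lt_of_ne_zero hkq hxk.ne) hne hxj hxk hj hjq (hcount j hj) le_rfl
      ((le_shadowGrowth hκ (by linarith [le_iterate_shadowGrowth hκ le_rfl e])).trans
        (by rwa [Function.iterate_succ_apply'] at hR))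
      (Shadows.refl le_rfl (by linarith) (by linarith) fun h =>
        H.ne_of_ne K.order (m := M) hj hjq hk hkq hne (by linarith))
    linarith
  · exact hopp j k hj hjq hk hkq h1.le h2
  · rw [relVel_comm]; exact hopp k j hk hkq hj hjq h2.le h1
  rcases eq_or_lt_of_le h1 with h1 | h1
  · exact hopp j k hj hjq hk hkq h1.ge h2
  rcases eq_or_lt_of_le h2 with h2 | h2
  · rw [relVel_comm]; exact hopp k j hk hkq hj hjq h2.ge h1.le
  have hxj := (H.pos_iff K.order hj hjq).1 h1
  have hxk := (H.pos_iff K.order hk hkq).1 h2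
  have := K.posEstimate (K.negEstimate e) M j k j 1 (by omega) le_rfl hj
    (K.order.lt_of_ne_zero hjq hxj.ne')
    hk (K.order.lt_of_ne_zero hkq hxk.ne') hne hxj hxk hj hjq (hcount j hj) le_rfl hR
    (Shadows.refl le_rfl (by linarith) (by linarith) fun h =>
      H.ne_of_ne K.order (m := M) hj hjq hk hkq hne (by linarith))
  have h0 : 0 ≤ g * (ε / 2) ^ min (plusRun x j) (plusRun x k) := by positivity
  linarith

end ControlledOrbit

/-! ### Choice of constants and uniform decay. -/

open Filter Topology in
theorem eventually_largeExponent {κ ε : ℝ} (hκ : 0 ≤ κ) (hε : 0 < ε) (R : ℝ) :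
    ∀ᶠ ℓ : ℝ in atTop, LargeExponent κ ε R ℓ := by
  have he := Real.exp_pos (-κ)
  have h1 : Tendsto (fun ℓ : ℝ => 1 / ℓ) atTop (𝓝 0) := by
    simpa using tendsto_inv_atTop_zero (𝕜 := ℝ)
  have h2 : Tendsto (fun ℓ : ℝ => R * (1 - Real.exp (-(κ / ℓ)))) atTop (𝓝 0) := by
    have h3 : Tendsto (fun ℓ : ℝ => -(κ / ℓ)) atTop (𝓝 0) := by
      simpa using (tendsto_const_nhds.div_atTop tendsto_id : Tendsto (fun ℓ : ℝ => κ / ℓ) _ _).neg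
    have h4 := (Real.continuous_exp.tendsto 0).comp h3
    simpa using (h4.const_sub 1).const_mul R
  have h5 : Tendsto (fun ℓ : ℝ => (1 + Real.exp (-κ)) ^ ℓ) atTop atTop :=
    tendsto_rpow_atTop_of_base_gt_one _ (by linarith)
  have he1 : Real.exp (-κ) ≤ 1 := Real.exp_le_one_iff.2 (by linarith)
  have h6 : Tendsto (fun ℓ : ℝ => (1 - Real.exp (-κ) / 2) ^ ℓ) atTop (𝓝 0) :=
    tendsto_rpow_atTop_of_base_lt_one _ (by linarith) (by linarith)
  filter_upwards [eventually_ge_atTop 1, h1.eventually (eventually_le_nhds (half_pos hε)),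
    h2.eventually (eventually_le_nhds one_half_pos), h5.eventually_gt_atTop 4,
    h6.eventually (eventually_le_nhds he)] with ℓ a1 a2 a3 a4 a5
  exact ⟨a1, a2, a3, a4, a5⟩

theorem VelBound.nonneg {q : ℕ} {y v : ℕ → ℕ → ℝ} {m : ℕ} {g : ℝ} (hq : 1 ≤ q)
    (h : VelBound q y v m g) : 0 ≤ g :=
  (abs_nonneg _).trans (h 1 1 le_rfl hq le_rfl hq)

theorem VelBound.mono {q : ℕ} {y v : ℕ → ℕ → ℝ} {m : ℕ} {g g' : ℝ}
    (h : VelBound q y v m g) (hg : g ≤ g') : VelBound q y v m g' :=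
  fun j k hj hjq hk hkq => (h j k hj hjq hk hkq).trans hg

namespace PullbackOrbit

variable {q : ℕ} {x ℓ : ℕ → ℝ} {y v : ℕ → ℕ → ℝ}

theorem shift (H : PullbackOrbit q x ℓ y v) (N : ℕ) :
    PullbackOrbit q x ℓ (fun m => y (N + m)) (fun m => v (N + m)) where
  lt m := H.lt (N + m)
  y_last m := H.y_last (N + m)
  v_last m := H.v_last (N + m)
  one_le m := H.one_le (N + m)
  neg_le_two m := H.neg_le_two (N + m)
  le_two m := H.le_two (N + m)
  y_rec m := H.y_rec (N + m)
  v_rec m := H.v_rec (N + m)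

/-- A crude bound from `σ ≤ 1`, for the initial levels where the contraction estimate is not yet
available. -/
theorem velBound_succ (H : PullbackOrbit q x ℓ y v) (C : CriticalOrder q x)
    (hℓ : ∀ j, 1 ≤ ℓ j) (hsame : ∀ j k, (x j < 0 ↔ x k < 0) → ℓ j = ℓ k) {m : ℕ} {g : ℝ}
    (hb : VelBound q y v m g) : VelBound q y v (m + 1) (2 * g) := by
  have hq2 := C.two_le
  have hg := hb.nonneg (by omega)
  have hlast : ∀ j, 1 ≤ j → j ≤ q → |relVel y v (m + 1) j q| ≤ 2 * g := by
    intro j hj hjq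
    rcases eq_or_lt_of_le hjq with rfl | h
    · rw [relVel, sub_self, zero_div, abs_zero]; linarith
    · have h1 := hℓ j
      rw [H.relVel_last hj h (by linarith), abs_div, abs_of_pos (by linarith : 0 < ℓ j),
        div_le_iff₀ (by linarith)]
      have := hb (j + 1) 1 (by omega) (by omega) le_rfl (by omega)
      nlinarith
  have hopp : ∀ j k, 1 ≤ j → j ≤ q → 1 ≤ k → k ≤ q → y (m + 1) j ≤ 0 → 0 ≤ y (m + 1) k →
      |relVel y v (m + 1) j k| ≤ 2 * g := fun j k hj hjq hk hkq h1 h2 =>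
    H.relVel_of_nonpos_of_nonneg C hj hjq hk hkq h1 h2 (hlast j hj hjq) (hlast k hk hkq)
  have hlt : ∀ j k, 1 ≤ j → j < q → 1 ≤ k → k < q → (x j < 0 ↔ x k < 0) →
      y m (k + 1) < y m (j + 1) → |relVel y v (m + 1) j k| ≤ 2 * g := by
    intro j k hj hjq hk hkq hjk h
    obtain ⟨σ, h0, h1, h2, -⟩ := H.relVel_succ_le C hj hjq hk hkq hjk (hsame j k hjk) (hℓ k) h
    have e1 := hb (j + 1) (k + 1) (by omega) (by omega) (by omega) (by omega)
    have e2 := hb (k + 1) 1 (by omega) (by omega) (by omega) (by omega)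
    have e3 := abs_nonneg (relVel y v m (j + 1) (k + 1))
    have e4 := abs_nonneg (relVel y v m (k + 1) 1)
    nlinarith
  intro j k hj hjq hk hkq
  by_cases hne : j = k
  · rw [hne, relVel, sub_self, zero_div, abs_zero]; linarith
  rcases eq_or_lt_of_le hjq with rfl | hjq
  · rw [relVel_comm]; exact hlast k hk hkq
  rcases eq_or_lt_of_le hkq with rfl | hkq
  · exact hlast j hj hjq.le
  by_cases hjk : x j < 0 ↔ x k < 0
  · rcases lt_or_gt_of_ne (H.ne_of_ne C (m := m) (j := j + 1) (k := k + 1) (by omega) (by omega)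
      (by omega) (by omega) (by omega)) with h | h
    · rw [relVel_comm]; exact hlt k j hk hkq hj hjq hjk.symm h
    · exact hlt j k hj hjq hk hkq hjk h
  · rw [← H.neg_iff C (m := m + 1) hj hjq.le, ← H.neg_iff C (m := m + 1) hk hkq.le] at hjk
    rcases lt_or_ge (y (m + 1) j) 0 with h1 | h1 <;> rcases lt_or_ge (y (m + 1) k) 0 with h2 | h2
    · simp [h1, h2] at hjk
    · exact hopp j k hj hjq.le hk hkq.le h1.le h2
    · rw [relVel_comm]; exact hopp k j hk hkq.le hj hjq.le h2.le h1
    · simp [h1.not_gt, h2.not_gt] at hjk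

theorem velBound_pow (H : PullbackOrbit q x ℓ y v) (C : CriticalOrder q x)
    (hℓ : ∀ j, 1 ≤ ℓ j) (hsame : ∀ j k, (x j < 0 ↔ x k < 0) → ℓ j = ℓ k) {g : ℝ}
    (hb : VelBound q y v 0 g) (m : ℕ) : VelBound q y v m (2 ^ m * g) := by
  induction m with
  | zero => simpa using hb
  | succ m ih =>
    have := H.velBound_succ C hℓ hsame ih
    rwa [← mul_assoc, ← pow_succ'] at this

end PullbackOrbit

/-- For large exponents the relative velocities decay geometrically under pullback, uniformly in
the orbit. -/
theorem exists_velBound_decay (L : ℕ) : ∃ ℓ₀ : ℝ, 2 ≤ ℓ₀ ∧ ∀ (q : ℕ) (x ℓ : ℕ → ℝ),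
    CriticalOrder q x → negCount q x 1 ≤ L → (∀ j, ℓ₀ ≤ ℓ j) →
    (∀ j k, (x j < 0 ↔ x k < 0) → ℓ j = ℓ k) → ∃ D : ℕ, ∀ (y v : ℕ → ℕ → ℝ) (g : ℝ),
      PullbackOrbit q x ℓ y v → VelBound q y v 0 g →
      ∀ n, VelBound q y v (n * D) (2 ^ D * g / 2 ^ n) := by
  -- The constants `c`, `ε`, `κ`, `R`, `ℓ₀` are fixed in this order, depending only on `L`: `ε`
  -- beats the loss `c`, `κ` makes `1 / κ ≤ ε / 2`, and `R` allows for `L + 1` growths of the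
  -- shadowing constant.
  set c := contractionFactor (L + 1)
  have hc : 3 ≤ c := three_le_contractionFactor _
  set ε : ℝ := 1 / (2 * c) with hεdef
  have hε : 0 < ε := by positivity
  have hε1 : ε ≤ 1 := by rw [hεdef, div_le_one (by positivity)]; linarith
  have hcε : c * ε ≤ 1 / 2 := by rw [hεdef]; field_simp; norm_num
  set κ : ℝ := 2 / ε with hκdef
  have hκ : 2 ≤ κ := by rw [hκdef, le_div_iff₀ hε]; linarith
  have hκε : 1 / κ ≤ ε / 2 := by rw [hκdef, one_div_div]
  set R := (shadowGrowth κ)^[L + 1] 1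
  obtain ⟨ℓ₀, hℓ₀⟩ := Filter.eventually_atTop.1 (eventually_largeExponent (κ := κ) (by linarith) hε R)
  refine ⟨max ℓ₀ 2, le_max_right _ _, fun q x ℓ C hL hℓ hsame => ?_⟩
  have hlarge : ∀ j, LargeExponent κ ε R (ℓ j) := fun j =>
    hℓ₀ _ ((le_max_left _ _).trans (hℓ j))
  set D := (L + 2) * (q + 2)
  refine ⟨D, fun y v g H hb n => ?_⟩
  have hq2 := C.two_le
  have hg := hb.nonneg (by omega)
  have half : ∀ {y v : ℕ → ℕ → ℝ} {g : ℝ} {M : ℕ}, PullbackOrbit q x ℓ y v → 0 ≤ g →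
      (∀ m < M, VelBound q y v m g) → D ≤ M → VelBound q y v M (g / 2) :=
    fun H hg hb hM => ControlledOrbit.velBound_half
      ⟨C, H, hlarge, hsame, hκ, hκε, hε, hε1, hg, hb⟩ hL le_rfl hcε hM
  have main : ∀ n m, n * D ≤ m → VelBound q y v m (2 ^ D * g / 2 ^ n) := by
    intro n
    induction n with
    | zero =>
      intro m _
      rw [pow_zero, div_one]
      have hg' : 0 ≤ 2 ^ D * g := by positivity
      induction m using Nat.strong_induction_on with
      | _ m ih =>
        rcases lt_or_ge m D with h | h
        · refine (H.velBound_pow C (fun j => (hlarge j).one_le) hsame hb m).mono ?_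
          exact mul_le_mul_of_nonneg_right (pow_le_pow_right₀ one_le_two h.le) hg
        · exact (half H hg' (fun i hi => ih i hi (by omega)) h).mono (by linarith)
    | succ n ih =>
      intro m hm
      have hm' : n * D + D ≤ m := by rwa [Nat.succ_mul] at hm
      -- The orbit is restarted at level `n * D`, from which on the better bound holds.
      have h1 := half (H.shift (n * D)) (g := 2 ^ D * g / 2 ^ n) (M := m - n * D) (by positivity)
        (fun i _ => ih (n * D + i) (by omega)) (by omega)
      have h2 : VelBound q y v (n * D + (m - n * D)) (2 ^ D * g / 2 ^ n / 2) := h1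
      rw [Nat.add_sub_cancel' (by omega), div_div, ← pow_succ] at h2
      exact h2
  exact main n _ le_rfl

/-- The velocity of the critical value decays under pullback. -/
theorem PullbackOrbit.abs_v_one_le {q : ℕ} {x ℓ : ℕ → ℝ} {y v : ℕ → ℕ → ℝ} {m : ℕ} {g : ℝ}
    (H : PullbackOrbit q x ℓ y v) (C : CriticalOrder q x) (hb : VelBound q y v m g) :
    |v m 1| ≤ 2 * g := by
  have hq2 := C.two_le
  rw [H.v_eq C le_rfl (by omega), abs_mul]
  have h1 : |y m 1| ≤ 2 := by
    rw [abs_le]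
    constructor <;> linarith [H.one_le m, H.neg_le_two m]
  exact mul_le_mul h1 (hb 1 q le_rfl (by omega) (by omega) le_rfl) (abs_nonneg _) (by norm_num)

/-! ### The critical orbit of the unimodal map and its order. -/

/-- The exponent of `unimodalMap ℓm ℓp c` on the side of `t`. -/
noncomputable def sideExponent (ℓm ℓp t : ℝ) : ℝ := if t < 0 then ℓm else ℓp

theorem le_sideExponent {ℓm ℓp a : ℝ} (hm : a ≤ ℓm) (hp : a ≤ ℓp) (t : ℝ) :
    a ≤ sideExponent ℓm ℓp t := by
  unfold sideExponent; split_ifs <;> assumption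

theorem unimodalMap_eq {ℓm ℓp : ℝ} (hm : 0 < ℓm) (hp : 0 < ℓp) (c t : ℝ) :
    unimodalMap ℓm ℓp c t = |t| ^ sideExponent ℓm ℓp t + c := by
  unfold unimodalMap sideExponent
  rcases lt_trichotomy t 0 with h | rfl | h
  · rw [if_pos h.le, if_pos h]
  · simp [Real.zero_rpow hm.ne', Real.zero_rpow hp.ne']
  · rw [if_neg h.not_ge, if_neg h.not_gt]

/-- The critical point `0` of the unimodal map has exact period `q`. -/
structure CriticalPeriod (ℓm ℓp c : ℝ) (q : ℕ) : Prop where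
  two_le_left : 2 ≤ ℓm
  two_le_right : 2 ≤ ℓp
  two_le : 2 ≤ q
  iterate_eq : (unimodalMap ℓm ℓp c)^[q] 0 = 0
  iterate_ne : ∀ j, 1 ≤ j → j < q → (unimodalMap ℓm ℓp c)^[j] 0 ≠ 0

namespace CriticalPeriod

variable {ℓm ℓp c : ℝ} {q : ℕ} {x : ℕ → ℝ}

theorem orbit_succ (P : CriticalPeriod ℓm ℓp c q) (hx : ∀ j, x j = (unimodalMap ℓm ℓp c)^[j] 0)
    (j : ℕ) : x (j + 1) = |x j| ^ sideExponent ℓm ℓp (x j) + c := by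
  have h1 := P.two_le_left
  have h2 := P.two_le_right
  rw [hx, Function.iterate_succ_apply', ← hx, unimodalMap_eq (by linarith) (by linarith)]

theorem orbit_one (P : CriticalPeriod ℓm ℓp c q) (hx : ∀ j, x j = (unimodalMap ℓm ℓp c)^[j] 0) :
    x 1 = c := by
  have h0 : x 0 = 0 := by rw [hx]; rfl
  have h1 := le_sideExponent P.two_le_left P.two_le_right (x 0)
  have h2 := P.orbit_succ hx 0
  rw [zero_add, h0, abs_zero, Real.zero_rpow (by rw [← h0]; linarith), zero_add] at h2
  exact h2

theorem orbit_last (P : CriticalPeriod ℓm ℓp c q) (hx : ∀ j, x j = (unimodalMap ℓm ℓp c)^[j] 0) :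
    x q = 0 := by
  rw [hx]; exact P.iterate_eq

theorem orbit_ne (P : CriticalPeriod ℓm ℓp c q) (hx : ∀ j, x j = (unimodalMap ℓm ℓp c)^[j] 0)
    {j : ℕ} (h1 : 1 ≤ j) (hq : j < q) : x j ≠ 0 := by
  rw [hx]; exact P.iterate_ne j h1 hq

theorem orbit_rec (P : CriticalPeriod ℓm ℓp c q) (hx : ∀ j, x j = (unimodalMap ℓm ℓp c)^[j] 0)
    (j : ℕ) : |x j| ^ sideExponent ℓm ℓp (x j) = x (j + 1) - x 1 := by
  rw [P.orbit_succ hx j, P.orbit_one hx]; ring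

/-- For `-1 < c < 0` the orbit would stay in `[c, 0)`, where `|x| ^ ℓ < |x| ≤ -c`, and never return
to `0`. -/
theorem param_le (P : CriticalPeriod ℓm ℓp c q) (hx : ∀ j, x j = (unimodalMap ℓm ℓp c)^[j] 0) :
    c ≤ -1 := by
  have hq2 := P.two_le
  have hlast := P.orbit_last hx
  have h1 := P.orbit_one hx
  have hge : ∀ j, 1 ≤ j → c ≤ x j := by
    intro j hj
    obtain ⟨j, rfl⟩ : ∃ i, j = i + 1 := ⟨j - 1, by omega⟩
    have := Real.rpow_nonneg (abs_nonneg (x j)) (sideExponent ℓm ℓp (x j))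
    linarith [P.orbit_succ hx j]
  have hc0 : c < 0 := by
    refine lt_of_le_of_ne ?_ fun h => P.orbit_ne hx le_rfl (by omega) (h1.trans h)
    have := hge q (by omega)
    linarith
  by_contra hcon
  have hneg : ∀ j, 1 ≤ j → x j < 0 := by
    intro j hj
    induction j, hj using Nat.le_induction with
    | base => rw [h1]; exact hc0
    | succ j hj ih =>
      have h3 := hge j hj
      have h4 : |x j| ^ sideExponent ℓm ℓp (x j) < |x j| := by
        have h5 := le_sideExponent P.two_le_left P.two_le_right (x j)
        have h6 : |x j| < 1 := by rw [abs_of_neg ih]; linarith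
        calc _ < |x j| ^ (1 : ℝ) :=
              Real.rpow_lt_rpow_of_exponent_gt (abs_pos.2 ih.ne) h6 (by linarith)
          _ = _ := Real.rpow_one _
      rw [abs_of_neg ih] at h4
      have := P.orbit_succ hx j
      rw [abs_of_neg ih] at this
      linarith
  linarith [hneg q (by omega)]

/-- If `x j = x k` with `j < k`, then `q - k` further steps give `x (q - k + j) = x q = 0`, too
early. -/
theorem orbit_inj (P : CriticalPeriod ℓm ℓp c q) (hx : ∀ j, x j = (unimodalMap ℓm ℓp c)^[j] 0)
    {j k : ℕ} (hj : 1 ≤ j) (hjq : j ≤ q) (hk : 1 ≤ k) (hkq : k ≤ q) (h : x j = x k) : j = k := by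
  have key : ∀ {j k : ℕ}, 1 ≤ j → j < k → k ≤ q → x j ≠ x k := by
    intro j k hj hjk hkq h
    refine P.orbit_ne hx (j := q - k + j) (by omega) (by omega) ?_
    rw [← P.orbit_last hx]
    conv_rhs => rw [← Nat.sub_add_cancel hkq]
    rw [hx, hx, Function.iterate_add_apply, Function.iterate_add_apply, ← hx, ← hx k, h]
  rcases lt_trichotomy j k with hlt | heq | hlt
  · exact absurd h (key hj hlt hkq)
  · exact heq
  · exact absurd h.symm (key hk hlt hjq)

/-- If the largest absolute value `a` exceeded `2`, the recursion at its index would give `a ^ 2 ≤ 2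
* a`. -/
theorem orbit_abs_le (P : CriticalPeriod ℓm ℓp c q)
    (hx : ∀ j, x j = (unimodalMap ℓm ℓp c)^[j] 0) {j : ℕ} (hj : 1 ≤ j) (hjq : j ≤ q) :
    |x j| ≤ 2 := by
  obtain ⟨k, hk, hmax⟩ := Finset.exists_max_image (Finset.Icc 1 q) (fun j => |x j|)
    ⟨j, Finset.mem_Icc.2 ⟨hj, hjq⟩⟩
  rw [Finset.mem_Icc] at hk
  refine (hmax j (Finset.mem_Icc.2 ⟨hj, hjq⟩)).trans ?_
  by_contra hcon
  rw [not_le] at hcon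
  have hkq : k < q := by
    refine lt_of_le_of_ne hk.2 fun h => ?_
    rw [h, P.orbit_last hx, abs_zero] at hcon
    linarith
  have h1 := hmax (k + 1) (Finset.mem_Icc.2 ⟨by omega, hkq⟩)
  have h2 := hmax 1 (Finset.mem_Icc.2 ⟨le_rfl, by omega⟩)
  have h3 := P.orbit_rec hx k
  have h4 : |x k| ^ (2 : ℝ) ≤ |x k| ^ sideExponent ℓm ℓp (x k) :=
    Real.rpow_le_rpow_of_exponent_le (by linarith)
      (le_sideExponent P.two_le_left P.two_le_right _)
  rw [Real.rpow_two] at h4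
  have h5 := le_abs_self (x (k + 1))
  have h6 := neg_le_abs (x 1)
  nlinarith

theorem orbit_mono_pos (P : CriticalPeriod ℓm ℓp c q)
    (hx : ∀ j, x j = (unimodalMap ℓm ℓp c)^[j] 0) {j k : ℕ} (hj : 0 < x j) (hjk : x j ≤ x k) :
    x (j + 1) ≤ x (k + 1) := by
  have hk : 0 < x k := hj.trans_le hjk
  rw [P.orbit_succ hx, P.orbit_succ hx, sideExponent, sideExponent, if_neg hj.not_gt,
    if_neg hk.not_gt, abs_of_pos hj, abs_of_pos hk]
  have := Real.rpow_le_rpow hj.le hjk (by linarith [P.two_le_right] : 0 ≤ ℓp)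
  linarith

/-- Consider the predecessor of a maximal point. If negative, it lies above `x 1`, so its image is
at most `x 2`. If positive, monotonicity makes the successor of the maximal point at least as large,
contradicting injectivity. -/
theorem orbit_le_second (P : CriticalPeriod ℓm ℓp c q)
    (hx : ∀ j, x j = (unimodalMap ℓm ℓp c)^[j] 0) {j : ℕ} (hj : 1 ≤ j) (hjq : j ≤ q) :
    x j ≤ x 2 := by
  have hq2 := P.two_le
  obtain ⟨k, hk, hmax⟩ := Finset.exists_max_image (Finset.Icc 1 q) x
    ⟨j, Finset.mem_Icc.2 ⟨hj, hjq⟩⟩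
  rw [Finset.mem_Icc] at hk
  refine (hmax j (Finset.mem_Icc.2 ⟨hj, hjq⟩)).trans ?_
  have hc := P.param_le hx
  have h1 := P.orbit_one hx
  have hk2 : 2 ≤ k := by
    by_contra hcon
    have hk1 : k = 1 := by omega
    have := hmax q (Finset.mem_Icc.2 ⟨by omega, le_rfl⟩)
    rw [hk1, P.orbit_last hx, h1] at this
    linarith
  obtain ⟨i, rfl⟩ : ∃ i, k = i + 1 := ⟨k - 1, by omega⟩
  rcases lt_or_gt_of_ne (P.orbit_ne hx (j := i) (by omega) (by omega)) with hneg | hpos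
  · have hi : c ≤ x i := by
      obtain ⟨l, rfl⟩ : ∃ l, i = l + 1 := ⟨i - 1, by omega⟩
      have := Real.rpow_nonneg (abs_nonneg (x l)) (sideExponent ℓm ℓp (x l))
      linarith [P.orbit_succ hx l]
    have e1 := P.orbit_succ hx i
    have e2 := P.orbit_succ hx 1
    have hx1 : x 1 < 0 := by linarith
    rw [sideExponent, if_pos hneg, abs_of_neg hneg] at e1
    rw [sideExponent, if_pos hx1, abs_of_neg hx1] at e2
    rw [e1, e2]
    have := Real.rpow_le_rpow (by linarith) (by linarith : -x i ≤ -x 1)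
      (by linarith [P.two_le_left] : 0 ≤ ℓm)
    linarith
  · have hle := hmax i (Finset.mem_Icc.2 ⟨by omega, by omega⟩)
    rcases eq_or_lt_of_le hk.2 with h | h
    · rw [h, P.orbit_last hx] at hle
      linarith
    · have h2 := P.orbit_mono_pos hx hpos hle
      have h3 := hmax (i + 1 + 1) (Finset.mem_Icc.2 ⟨by omega, h⟩)
      have := P.orbit_inj hx (j := i + 1) (k := i + 1 + 1) (by omega) (by omega) (by omega) h
        (le_antisymm h2 h3)
      omega

theorem criticalOrder (P : CriticalPeriod ℓm ℓp c q)
    (hx : ∀ j, x j = (unimodalMap ℓm ℓp c)^[j] 0) : CriticalOrder q x where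
  two_le := P.two_le
  last := P.orbit_last hx
  ne_zero _ h1 hq := P.orbit_ne hx h1 hq
  first_lt j h2 hq := by
    obtain ⟨i, rfl⟩ : ∃ i, j = i + 1 := ⟨j - 1, by omega⟩
    have := Real.rpow_pos_of_pos (abs_pos.2 (P.orbit_ne hx (j := i) (by omega) (by omega)))
      (sideExponent ℓm ℓp (x i))
    linarith [P.orbit_rec hx i]
  second_nonneg := by
    have := P.two_le
    rw [← P.orbit_last hx]
    exact P.orbit_le_second hx (by omega) le_rfl
  inj _ _ hj hjq hk hkq h := P.orbit_inj hx hj hjq hk hkq h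
  run_le j hj hjq := by
    have hne : {h | x (2 + h) ≤ 0}.Nonempty := ⟨q - 2, by
      rw [Set.mem_ofPred_eq, Nat.add_sub_cancel' P.two_le, P.orbit_last hx]⟩
    have hr : x (2 + plusRun x 2) ≤ 0 := Nat.sInf_mem hne
    by_contra hcon
    have hpos : ∀ h ≤ plusRun x 2, 0 < x (j + h) := by
      intro h hh
      by_contra hneg
      have : plusRun x j ≤ h := Nat.sInf_le (not_lt.1 hneg)
      omega
    have hle : ∀ h ≤ plusRun x 2, x (j + h) ≤ x (2 + h) := by
      intro h
      induction h with
      | zero => intro _; exact P.orbit_le_second hx hj hjq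
      | succ h ih => intro hh; exact P.orbit_mono_pos hx (hpos h (by omega)) (ih (by omega))
    linarith [hpos _ le_rfl, hle _ le_rfl]

/-- Orbits with the same kneading sequence are ordered in the same way. -/
theorem orbit_lt_of_lt {c' : ℝ} {x' : ℕ → ℝ} (P : CriticalPeriod ℓm ℓp c q)
    (hx : ∀ j, x j = (unimodalMap ℓm ℓp c)^[j] 0) (P' : CriticalPeriod ℓm ℓp c' q)
    (hx' : ∀ j, x' j = (unimodalMap ℓm ℓp c')^[j] 0)
    (hsign : ∀ j, 1 ≤ j → j ≤ q → SignType.sign (x j) = SignType.sign (x' j)) :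
    ∀ n j k, n + max j k = q → 1 ≤ j → 1 ≤ k → x j < x k → x' j < x' k := by
  have hneg : ∀ j, 1 ≤ j → j ≤ q → (x j < 0 ↔ x' j < 0) := fun j h1 hq => by
    rw [← sign_eq_neg_one_iff, ← sign_eq_neg_one_iff, hsign j h1 hq]
  have hpos : ∀ j, 1 ≤ j → j ≤ q → (0 < x j ↔ 0 < x' j) := fun j h1 hq => by
    rw [← sign_eq_one_iff, ← sign_eq_one_iff, hsign j h1 hq]
  have hmix : ∀ j k, 1 ≤ j → j ≤ q → 1 ≤ k → k ≤ q → x j ≤ 0 → 0 ≤ x k → x j < x k →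
      x' j < x' k := by
    intro j k hj hjq hk hkq h1 h2 h3
    have h1' : x' j ≤ 0 := by rw [← not_lt, ← hpos j hj hjq, not_lt]; exact h1
    have h2' : 0 ≤ x' k := by rw [← not_lt, ← hneg k hk hkq, not_lt]; exact h2
    rcases eq_or_lt_of_le h1 with h | h
    · exact h1'.trans_lt ((hpos k hk hkq).1 (h ▸ h3))
    · exact ((hneg j hj hjq).1 h).trans_le h2'
  have hm := P.two_le_left
  have hp := P.two_le_right
  -- Backward induction from the index `q`: the order of two points on one side of `0` is decided by
  -- their successors, and otherwise by the signs.
  intro n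
  induction n with
  | zero =>
    intro j k hjk hj hk h
    rcases max_choice j k with hm | hm
    · have hjq : j = q := by omega
      subst hjq
      have h0 := P.orbit_last hx
      exact hmix j k hj le_rfl hk (by omega) h0.le (h0 ▸ h.le) h
    · have hkq : k = q := by omega
      subst hkq
      have h0 := P.orbit_last hx
      exact hmix j k hj (by omega) hk le_rfl (h0 ▸ h.le) h0.ge h
  | succ n ih =>
    intro j k hjk hj hk h
    have hjq : j < q := by omega
    have hkq : k < q := by omega
    have rj := P.orbit_rec hx j
    have rk := P.orbit_rec hx k
    have rj' := P'.orbit_rec hx' j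
    have rk' := P'.orbit_rec hx' k
    have ihjk := ih (j + 1) (k + 1) (by omega) (by omega) (by omega)
    have ihkj := ih (k + 1) (j + 1) (by omega) (by omega) (by omega)
    rcases lt_or_gt_of_ne (P.orbit_ne hx hj hjq) with h1 | h1
    · rcases lt_or_gt_of_ne (P.orbit_ne hx hk hkq) with h2 | h2
      · have h1' := (hneg j hj hjq.le).1 h1
        have h2' := (hneg k hk hkq.le).1 h2
        rw [sideExponent, if_pos h1, abs_of_neg h1] at rj
        rw [sideExponent, if_pos h2, abs_of_neg h2] at rk
        rw [sideExponent, if_pos h1', abs_of_neg h1'] at rj'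
        rw [sideExponent, if_pos h2', abs_of_neg h2'] at rk'
        have := Real.rpow_lt_rpow (by linarith) (by linarith : -x k < -x j)
          (by linarith : 0 < ℓm)
        have h3 := ihkj (by linarith)
        have h4 : (-x' k) ^ ℓm < (-x' j) ^ ℓm := by linarith
        rw [Real.rpow_lt_rpow_iff (by linarith) (by linarith) (by linarith)] at h4
        linarith
      · exact hmix j k hj hjq.le hk hkq.le h1.le h2.le h
    · have h2 : 0 < x k := h1.trans h
      have h1' := (hpos j hj hjq.le).1 h1
      have h2' := (hpos k hk hkq.le).1 h2
      rw [sideExponent, if_neg h1.not_gt, abs_of_pos h1] at rj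
      rw [sideExponent, if_neg h2.not_gt, abs_of_pos h2] at rk
      rw [sideExponent, if_neg h1'.not_gt, abs_of_pos h1'] at rj'
      rw [sideExponent, if_neg h2'.not_gt, abs_of_pos h2'] at rk'
      have := Real.rpow_lt_rpow h1.le h (by linarith : 0 < ℓp)
      have h3 := ihjk (by linarith)
      have h4 : (x' j) ^ ℓp < (x' k) ^ ℓp := by linarith
      rwa [Real.rpow_lt_rpow_iff h1'.le h2'.le (by linarith)] at h4

end CriticalPeriod

/-! ### Derivatives along the critical orbit and positivity of the sum. -/

theorem hasDerivAt_unimodalMap {ℓm ℓp : ℝ} (c : ℝ) {t : ℝ} (ht : t ≠ 0) :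
    HasDerivAt (unimodalMap ℓm ℓp c)
      (sideExponent ℓm ℓp t * |t| ^ sideExponent ℓm ℓp t / t) t := by
  rcases lt_or_gt_of_ne ht with h | h
  · have h1 : HasDerivAt (fun u : ℝ => (-u) ^ ℓm + c) (-1 * ℓm * (-t) ^ (ℓm - 1)) t :=
      ((hasDerivAt_neg t).rpow_const (Or.inl (by linarith))).add_const c
    rw [sideExponent, if_pos h, abs_of_neg h]
    have h2 : -1 * ℓm * (-t) ^ (ℓm - 1) = ℓm * (-t) ^ ℓm / t := by
      rw [Real.rpow_sub_one (by linarith)]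
      field_simp
    rw [h2] at h1
    refine h1.congr_of_eventuallyEq ?_
    filter_upwards [eventually_lt_nhds h] with u hu
    rw [unimodalMap, if_pos hu.le, abs_of_neg hu]
  · have h1 : HasDerivAt (fun u : ℝ => u ^ ℓp + c) (1 * ℓp * t ^ (ℓp - 1)) t :=
      ((hasDerivAt_id t).rpow_const (Or.inl ht)).add_const c
    rw [sideExponent, if_neg h.not_gt, abs_of_pos h]
    have h2 : 1 * ℓp * t ^ (ℓp - 1) = ℓp * t ^ ℓp / t := by
      rw [Real.rpow_sub_one ht]
      field_simp
    rw [h2] at h1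
    refine h1.congr_of_eventuallyEq ?_
    filter_upwards [eventually_gt_nhds h] with u hu
    rw [unimodalMap, if_neg hu.not_ge, abs_of_pos hu]

theorem exists_velBound (q : ℕ) (y v : ℕ → ℕ → ℝ) (m : ℕ) : ∃ g, VelBound q y v m g := by
  refine ⟨∑ j ∈ Finset.Icc 1 q, ∑ k ∈ Finset.Icc 1 q, |relVel y v m j k|,
    fun j k hj hjq hk hkq => ?_⟩
  refine (Finset.single_le_sum (f := fun k => |relVel y v m j k|) (fun _ _ => abs_nonneg _)
    (Finset.mem_Icc.2 ⟨hk, hkq⟩)).trans ?_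
  exact Finset.single_le_sum (f := fun j => ∑ k ∈ Finset.Icc 1 q, |relVel y v m j k|)
    (fun _ _ => Finset.sum_nonneg fun _ _ => abs_nonneg _) (Finset.mem_Icc.2 ⟨hj, hjq⟩)

/-- Relative velocities along pullback orbits decay geometrically, uniformly in the orbit. -/
def UniformDecay (q : ℕ) (x ℓ : ℕ → ℝ) : Prop :=
  ∃ D : ℕ, ∀ (y v : ℕ → ℕ → ℝ) (g : ℝ), PullbackOrbit q x ℓ y v → VelBound q y v 0 g →
    ∀ n, VelBound q y v (n * D) (2 ^ D * g / 2 ^ n)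

theorem exists_div_two_pow_lt (a : ℝ) {b : ℝ} (hb : 0 < b) : ∃ n : ℕ, a / 2 ^ n < b := by
  obtain ⟨n, hn⟩ := pow_unbounded_of_one_lt (a / b) (one_lt_two (α := ℝ))
  refine ⟨n, ?_⟩
  rw [div_lt_iff₀ hb] at hn
  rw [div_lt_iff₀ (by positivity)]
  linarith

namespace CriticalPeriod

variable {ℓm ℓp c : ℝ} {q : ℕ} {x : ℕ → ℝ}

/-- The derivative of the unimodal map at the point `x j` of the critical orbit. -/
noncomputable def slope (ℓm ℓp : ℝ) (x : ℕ → ℝ) (j : ℕ) : ℝ :=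
  sideExponent ℓm ℓp (x j) * |x j| ^ sideExponent ℓm ℓp (x j) / x j

theorem slope_ne_zero (P : CriticalPeriod ℓm ℓp c q)
    (hx : ∀ j, x j = (unimodalMap ℓm ℓp c)^[j] 0) {j : ℕ} (h1 : 1 ≤ j) (hq : j < q) :
    slope ℓm ℓp x j ≠ 0 := by
  have h := P.orbit_ne hx h1 hq
  have h2 := le_sideExponent P.two_le_left P.two_le_right (x j)
  have h3 := Real.rpow_pos_of_pos (abs_pos.2 h) (sideExponent ℓm ℓp (x j))
  exact div_ne_zero (mul_ne_zero (by linarith) h3.ne') h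

theorem deriv_iterate (P : CriticalPeriod ℓm ℓp c q)
    (hx : ∀ j, x j = (unimodalMap ℓm ℓp c)^[j] 0) {n : ℕ} (hn : n < q) :
    deriv ((unimodalMap ℓm ℓp c)^[n]) c = ∏ j ∈ Finset.range n, slope ℓm ℓp x (j + 1) := by
  refine HasDerivAt.deriv ?_
  induction n with
  | zero => simpa using hasDerivAt_id c
  | succ n ih =>
    have hpt : (unimodalMap ℓm ℓp c)^[n] c = x (n + 1) := by
      rw [hx, Function.iterate_succ_apply]
      congr 1
      have := P.orbit_one hx
      rw [hx, Function.iterate_one] at this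
      exact this.symm
    rw [Function.iterate_succ', Finset.prod_range_succ, mul_comm]
    refine HasDerivAt.comp c ?_ (ih (by omega))
    rw [hpt]
    exact hasDerivAt_unimodalMap c (P.orbit_ne hx (by omega) hn)

theorem prod_slope_ne_zero (P : CriticalPeriod ℓm ℓp c q)
    (hx : ∀ j, x j = (unimodalMap ℓm ℓp c)^[j] 0) {n : ℕ} (hn : n < q) :
    ∏ j ∈ Finset.range n, slope ℓm ℓp x (j + 1) ≠ 0 :=
  Finset.prod_ne_zero_iff.2 fun j hj => P.slope_ne_zero hx (by omega)
    (by have := Finset.mem_range.1 hj; omega)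

theorem orbit_one_mem (P : CriticalPeriod ℓm ℓp c q)
    (hx : ∀ j, x j = (unimodalMap ℓm ℓp c)^[j] 0) : 1 ≤ -x 1 ∧ -x 1 ≤ 2 := by
  have h1 := P.orbit_abs_le hx (j := 1) le_rfl (by linarith [P.two_le])
  have h2 := P.param_le hx
  have h3 := P.orbit_one hx
  rw [abs_le] at h1
  constructor <;> linarith

/-- The pullback operator at the critical orbit has no eigenvalue in `[1, ∞)`. -/
theorem sum_pow_div_ne_zero (P : CriticalPeriod ℓm ℓp c q)
    (hx : ∀ j, x j = (unimodalMap ℓm ℓp c)^[j] 0)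
    (hdecay : UniformDecay q x (fun j => sideExponent ℓm ℓp (x j))) {τ : ℝ} (h0 : 0 < τ)
    (h1 : τ ≤ 1) :
    ∑ n ∈ Finset.range q, τ ^ n / ∏ j ∈ Finset.range n, slope ℓm ℓp x (j + 1) ≠ 0 := by
  intro hzero
  obtain ⟨D, hD⟩ := hdecay
  set b : ℕ → ℝ := fun n => ∏ j ∈ Finset.range n, slope ℓm ℓp x (j + 1) with hb
  -- By `hrec`, `W` is an eigenvector of the linearised pullback at `x` with eigenvalue `1 / τ`; the
  -- vanishing of the sum is the closing condition `W q = 0`. Then `(1 / τ) ^ m * W` moves over the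
  -- constant configuration `x` without decaying at index `1`.
  set W : ℕ → ℝ := fun j => b (j - 1) / τ ^ (j - 1) * ∑ i ∈ Finset.range j, τ ^ i / b i with hW
  have hW1 : W 1 = 1 := by simp [hW, hb]
  have hWq : W q = 0 := by rw [hW]; exact mul_eq_zero_of_right _ hzero
  have hrec : ∀ j, 1 ≤ j → j < q → W (j + 1) - W 1 = slope ℓm ℓp x j * W j / τ := by
    intro j hj hjq
    obtain ⟨i, rfl⟩ : ∃ i, j = i + 1 := ⟨j - 1, by omega⟩
    have hbi : b (i + 1) = b i * slope ℓm ℓp x (i + 1) := Finset.prod_range_succ _ _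
    have hne : b (i + 1) ≠ 0 := P.prod_slope_ne_zero hx hjq
    have e1 : W (i + 1 + 1) = b (i + 1) / τ ^ (i + 1) *
        ((∑ k ∈ Finset.range (i + 1), τ ^ k / b k) + τ ^ (i + 1) / b (i + 1)) := by
      rw [← Finset.sum_range_succ]; rfl
    have e2 : W (i + 1) = b i / τ ^ i * ∑ k ∈ Finset.range (i + 1), τ ^ k / b k := rfl
    have e3 : b (i + 1) / τ ^ (i + 1) * (τ ^ (i + 1) / b (i + 1)) = 1 := by
      field_simp
    rw [hW1, e1, e2, mul_add, e3, add_sub_cancel_right, hbi, pow_succ]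
    field_simp
  have C := P.criticalOrder hx
  have hH : PullbackOrbit q x (fun j => sideExponent ℓm ℓp (x j)) (fun _ => x)
      (fun m j => (1 / τ) ^ m * W j) :=
    { lt := fun _ _ _ _ _ _ _ h => h
      y_last := fun _ => P.orbit_last hx
      v_last := fun m => by rw [hWq, mul_zero]
      one_le := fun _ => (P.orbit_one_mem hx).1
      neg_le_two := fun _ => (P.orbit_one_mem hx).2
      le_two := fun _ j hj hjq => (le_abs_self _).trans (P.orbit_abs_le hx hj hjq)
      y_rec := fun _ j _ _ => P.orbit_rec hx j
      v_rec := fun m j hj hjq => by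
        have hne := P.orbit_ne hx hj hjq
        have hA := Real.rpow_pos_of_pos (abs_pos.2 hne) (sideExponent ℓm ℓp (x j))
        rw [← mul_sub, hrec j hj hjq, ← P.orbit_rec hx j, slope, pow_succ]
        field_simp }
  obtain ⟨g, hg⟩ := exists_velBound q (fun _ => x) (fun m j => (1 / τ) ^ m * W j) 0
  obtain ⟨n, hn⟩ := exists_div_two_pow_lt (2 ^ D * g) (b := 1 / 2) (by norm_num)
  have h2 := hH.abs_v_one_le C (hD _ _ g hH hg n)
  simp only [hW1, mul_one] at h2
  have h3 : 1 ≤ (1 / τ) ^ (n * D) := one_le_pow₀ ((one_le_div h0).2 h1)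
  have h4 := le_abs_self ((1 / τ) ^ (n * D))
  linarith

/-- Intermediate values: with weights `τ ^ n` the sum is `1` at `τ = 0` and has no zero in `(0, 1]`.
-/
theorem sum_one_div_deriv_pos (P : CriticalPeriod ℓm ℓp c q)
    (hx : ∀ j, x j = (unimodalMap ℓm ℓp c)^[j] 0)
    (hdecay : UniformDecay q x (fun j => sideExponent ℓm ℓp (x j))) :
    0 < ∑ n ∈ Finset.range q, 1 / deriv ((unimodalMap ℓm ℓp c)^[n]) c := by
  have hsum : ∑ n ∈ Finset.range q, 1 / deriv ((unimodalMap ℓm ℓp c)^[n]) c =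
      ∑ n ∈ Finset.range q, (1 : ℝ) ^ n / ∏ j ∈ Finset.range n, slope ℓm ℓp x (j + 1) :=
    Finset.sum_congr rfl fun n hn => by
      rw [P.deriv_iterate hx (Finset.mem_range.1 hn), one_pow]
  rw [hsum]
  by_contra hcon
  set F : ℝ → ℝ := fun τ =>
    ∑ n ∈ Finset.range q, τ ^ n / ∏ j ∈ Finset.range n, slope ℓm ℓp x (j + 1) with hF
  have hcont : Continuous F := by rw [hF]; fun_prop
  have hF0 : F 0 = 1 := by
    have hq := P.two_le
    rw [hF]
    simp only
    rw [Finset.sum_eq_single 0]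
    · simp
    · intro n _ hn; rw [zero_pow hn, zero_div]
    · intro h; exact absurd (Finset.mem_range.2 (by omega)) h
  obtain ⟨τ, hτ, hτ0⟩ := intermediate_value_Icc' (zero_le_one (α := ℝ)) hcont.continuousOn
    (show (0 : ℝ) ∈ Set.Icc (F 1) (F 0) from ⟨not_lt.1 hcon, by rw [hF0]; norm_num⟩)
  have hne : τ ≠ 0 := fun h => by rw [h, hF0] at hτ0; norm_num at hτ0
  exact P.sum_pow_div_ne_zero hx hdecay (lt_of_le_of_ne hτ.1 hne.symm) hτ.2 hτ0

end CriticalPeriod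

/-! ### Pulling back the segment between two critical orbits. -/

/-- The iterated pullbacks of the convex combination `(1 - s) x + s x'`. -/
noncomputable def pullbackPath (q : ℕ) (ℓ x x' : ℕ → ℝ) (s : ℝ) : ℕ → ℕ → ℝ
  | 0, j => (1 - s) * x j + s * x' j
  | m + 1, j => if 1 ≤ j ∧ j < q then (if x j < 0 then -1 else 1) *
      (pullbackPath q ℓ x x' s m (j + 1) - pullbackPath q ℓ x x' s m 1) ^ (1 / ℓ j) else 0

/-- The derivative of `pullbackPath` with respect to the parameter `s`. -/
noncomputable def pullbackVel (q : ℕ) (ℓ x x' : ℕ → ℝ) (s : ℝ) : ℕ → ℕ → ℝ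
  | 0, j => x' j - x j
  | m + 1, j => if 1 ≤ j ∧ j < q then pullbackPath q ℓ x x' s (m + 1) j *
      ((pullbackVel q ℓ x x' s m (j + 1) - pullbackVel q ℓ x x' s m 1) /
        (pullbackPath q ℓ x x' s m (j + 1) - pullbackPath q ℓ x x' s m 1) / ℓ j) else 0

theorem rpow_one_div_le_two {A ℓ : ℝ} (h0 : 0 ≤ A) (h4 : A ≤ 4) (hℓ : 2 ≤ ℓ) :
    A ^ (1 / ℓ) ≤ 2 := by
  have h1 : 1 / ℓ ≤ 1 / 2 := one_div_le_one_div_of_le two_pos hℓ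
  calc A ^ (1 / ℓ) ≤ 4 ^ (1 / ℓ) := Real.rpow_le_rpow h0 h4 (by positivity)
    _ ≤ 4 ^ (1 / 2 : ℝ) := Real.rpow_le_rpow_of_exponent_le (by norm_num) h1
    _ = 2 := by
      rw [← Real.sqrt_eq_rpow, show (4 : ℝ) = 2 ^ 2 by norm_num]
      exact Real.sqrt_sq two_pos.le

/-- The denominator is at least the smaller of `|a|`, `|b|` in size. This bounds the initial
relative velocities uniformly in `s`. -/
theorem abs_div_convexComb_le {a b u s : ℝ} (h0 : 0 ≤ s) (h1 : s ≤ 1) (hab : 0 < a * b) :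
    |u / ((1 - s) * a + s * b)| ≤ |u / a| + |u / b| := by
  have key : ∀ {a b : ℝ}, 0 < a → 0 < b → |u / ((1 - s) * a + s * b)| ≤ |u / a| + |u / b| := by
    intro a b ha hb
    rw [abs_div, abs_div, abs_div, abs_of_pos ha, abs_of_pos hb]
    have hu := abs_nonneg u
    have hmin : min a b ≤ (1 - s) * a + s * b := by
      nlinarith [min_le_left a b, min_le_right a b]
    have h2 : |u| / |(1 - s) * a + s * b| ≤ |u| / min a b :=
      div_le_div_of_nonneg_left hu (lt_min ha hb) (hmin.trans (le_abs_self _))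
    have h3 : 0 ≤ |u| / a := by positivity
    have h4 : 0 ≤ |u| / b := by positivity
    rcases min_choice a b with h | h <;> rw [h] at h2 <;> linarith
  rcases pos_and_pos_or_neg_and_neg_of_mul_pos hab with ⟨ha, hb⟩ | ⟨ha, hb⟩
  · exact key ha hb
  · have := key (neg_pos.2 ha) (neg_pos.2 hb)
    rw [div_neg, div_neg, abs_neg, abs_neg] at this
    rwa [show (1 - s) * -a + s * -b = -((1 - s) * a + s * b) by ring, div_neg, abs_neg] at this

/-- The conditions on `x` and `x'` under which the pullbacks of the segment between them are
defined. -/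
structure Comparable (q : ℕ) (ℓ x x' : ℕ → ℝ) : Prop where
  order : CriticalOrder q x
  two_le : ∀ j, 2 ≤ ℓ j
  same : ∀ j k, (x j < 0 ↔ x k < 0) → ℓ j = ℓ k
  last' : x' q = 0
  lt' : ∀ j k, 1 ≤ j → j ≤ q → 1 ≤ k → k ≤ q → x j < x k → x' j < x' k
  one_le : 1 ≤ -x 1
  one_le' : 1 ≤ -x' 1
  le_two : ∀ j, 1 ≤ j → j ≤ q → |x j| ≤ 2
  le_two' : ∀ j, 1 ≤ j → j ≤ q → |x' j| ≤ 2
  pow_eq : ∀ j, 1 ≤ j → j < q → |x j| ^ ℓ j = x (j + 1) - x 1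
  pow_eq' : ∀ j, 1 ≤ j → j < q → |x' j| ^ ℓ j = x' (j + 1) - x' 1

namespace Comparable

variable {q : ℕ} {ℓ x x' : ℕ → ℝ}

/-- The properties of a configuration that are preserved under pullback. -/
structure IsConfig (q : ℕ) (x z : ℕ → ℝ) : Prop where
  lt : ∀ j k, 1 ≤ j → j ≤ q → 1 ≤ k → k ≤ q → x j < x k → z j < z k
  last : z q = 0
  one_le : 1 ≤ -z 1
  neg_le_two : -z 1 ≤ 2
  le_two : ∀ j, 1 ≤ j → j ≤ q → z j ≤ 2

theorem IsConfig.diff_pos {z : ℕ → ℝ} (h : IsConfig q x z) (C : CriticalOrder q x) {j : ℕ}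
    (hj : 1 ≤ j) (hjq : j < q) : 0 < z (j + 1) - z 1 := by
  have := h.lt 1 (j + 1) le_rfl (by omega) (by omega) hjq (C.first_lt _ (by omega) hjq)
  linarith

theorem isConfig_zero (K : Comparable q ℓ x x') {s : ℝ} (h0 : 0 ≤ s) (h1 : s ≤ 1) :
    IsConfig q x (pullbackPath q ℓ x x' s 0) := by
  have hq := K.order.two_le
  have b1 := abs_le.1 (K.le_two 1 le_rfl (by omega))
  have b2 := abs_le.1 (K.le_two' 1 le_rfl (by omega))
  have o1 := K.one_le
  have o2 := K.one_le'
  constructor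
  · intro j k hj hjq hk hkq h
    have h' := K.lt' j k hj hjq hk hkq h
    simp only [pullbackPath]
    rcases eq_or_lt_of_le h1 with rfl | h1
    · linarith
    · nlinarith
  · simp [pullbackPath, K.order.last, K.last']
  · simp only [pullbackPath]; nlinarith
  · simp only [pullbackPath]; nlinarith
  · intro j hj hjq
    have b3 := abs_le.1 (K.le_two j hj hjq)
    have b4 := abs_le.1 (K.le_two' j hj hjq)
    simp only [pullbackPath]
    nlinarith

/-- Order is inherited because `x` satisfies the same recursion, so comparing `|x j|` and `|x k|`
compares successors. The bounds persist since `z 2 ≥ 0` gives `z 2 - z 1 ≥ 1`, and differences of at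
most `4` have roots of at most `2`. -/
theorem isConfig_succ (K : Comparable q ℓ x x') {s : ℝ} {m : ℕ}
    (h : IsConfig q x (pullbackPath q ℓ x x' s m)) :
    IsConfig q x (pullbackPath q ℓ x x' s (m + 1)) := by
  have C := K.order
  have hq := C.two_le
  set z := pullbackPath q ℓ x x' s m with hz
  set z' := pullbackPath q ℓ x x' s (m + 1) with hz'
  have hneg : ∀ j, 1 ≤ j → j < q → x j < 0 → z' j = -(z (j + 1) - z 1) ^ (1 / ℓ j) := by
    intro j hj hjq hx
    rw [hz', pullbackPath, if_pos ⟨hj, hjq⟩, if_pos hx, neg_one_mul]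
  have hpos : ∀ j, 1 ≤ j → j < q → 0 < x j → z' j = (z (j + 1) - z 1) ^ (1 / ℓ j) := by
    intro j hj hjq hx
    rw [hz', pullbackPath, if_pos ⟨hj, hjq⟩, if_neg hx.not_gt, one_mul]
  have hzq : z' q = 0 := by rw [hz', pullbackPath, if_neg (by omega)]
  have hr0 : ∀ j, 1 ≤ j → j < q → 0 < (z (j + 1) - z 1) ^ (1 / ℓ j) := fun j hj hjq =>
    Real.rpow_pos_of_pos (h.diff_pos C hj hjq) _
  have hr2 : ∀ j, 1 ≤ j → j < q → (z (j + 1) - z 1) ^ (1 / ℓ j) ≤ 2 := fun j hj hjq =>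
    rpow_one_div_le_two (h.diff_pos C hj hjq).le
      (by linarith [h.le_two (j + 1) (by omega) hjq, h.neg_le_two]) (K.two_le j)
  have hsignneg : ∀ j, 1 ≤ j → j ≤ q → x j < 0 → z' j < 0 := fun j hj hjq hx => by
    have hjq' := C.lt_of_ne_zero hjq hx.ne
    rw [hneg j hj hjq' hx]
    linarith [hr0 j hj hjq']
  have hsignpos : ∀ j, 1 ≤ j → j ≤ q → 0 < x j → 0 < z' j := fun j hj hjq hx => by
    have hjq' := C.lt_of_ne_zero hjq hx.ne'
    rw [hpos j hj hjq' hx]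
    exact hr0 j hj hjq'
  have hzero : ∀ j, 1 ≤ j → j ≤ q → x j = 0 → z' j = 0 := fun j hj hjq hx => by
    have : j = q := by
      by_contra hne
      exact C.ne_zero j hj (by omega) hx
    rw [this, hzq]
  have hlift : ∀ j k, 1 ≤ j → j < q → 1 ≤ k → k < q → |x j| < |x k| → (x j < 0 ↔ x k < 0) →
      (z (j + 1) - z 1) ^ (1 / ℓ j) < (z (k + 1) - z 1) ^ (1 / ℓ k) := by
    intro j k hj hjq hk hkq hlt hjk
    have h2 := K.two_le j
    have h3 := Real.rpow_lt_rpow (abs_nonneg (x j)) hlt (by linarith : 0 < ℓ j)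
    rw [K.pow_eq j hj hjq, K.same j k hjk, K.pow_eq k hk hkq] at h3
    have h4 := h.lt (j + 1) (k + 1) (by omega) hjq (by omega) hkq (by linarith)
    rw [← K.same j k hjk]
    exact Real.rpow_lt_rpow (h.diff_pos C hj hjq).le (by linarith) (by positivity)
  refine ⟨?_, hzq, ?_, ?_, ?_⟩
  · intro j k hj hjq hk hkq hlt
    rcases lt_trichotomy (x j) 0 with h1 | h1 | h1
    · have n1 := hsignneg j hj hjq h1
      rcases lt_trichotomy (x k) 0 with h2 | h2 | h2
      · have hjq' := C.lt_of_ne_zero hjq h1.ne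
        have hkq' := C.lt_of_ne_zero hkq h2.ne
        rw [hneg j hj hjq' h1, hneg k hk hkq' h2]
        have := hlift k j hk hkq' hj hjq' (by rw [abs_of_neg h1, abs_of_neg h2]; linarith)
          (by simp [h1, h2])
        linarith
      · rw [hzero k hk hkq h2]; exact n1
      · exact n1.trans (hsignpos k hk hkq h2)
    · rw [hzero j hj hjq h1]
      exact hsignpos k hk hkq (by linarith)
    · have h2 : 0 < x k := by linarith
      have hjq' := C.lt_of_ne_zero hjq h1.ne'
      have hkq' := C.lt_of_ne_zero hkq h2.ne'
      rw [hpos j hj hjq' h1, hpos k hk hkq' h2]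
      exact hlift j k hj hjq' hk hkq' (by rw [abs_of_pos h1, abs_of_pos h2]; linarith)
        (by simp [h1.not_gt, h2.not_gt])
  · rw [hneg 1 le_rfl (by omega) C.first_neg, neg_neg]
    refine Real.one_le_rpow ?_ (one_div_nonneg.2 (by linarith [K.two_le 1]))
    have h2 : 0 ≤ z (1 + 1) := by
      rcases eq_or_lt_of_le C.second_nonneg with h2 | h2
      · have h3 : 2 = q := C.inj 2 q (by omega) hq (by omega) le_rfl (by rw [← h2, C.last])
        rw [show 1 + 1 = q from h3, h.last]
      · have := h.lt q 2 (by omega) le_rfl (by omega) hq (by rwa [C.last])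
        rw [h.last] at this
        exact this.le
    linarith [h.one_le]
  · rw [hneg 1 le_rfl (by omega) C.first_neg, neg_neg]
    exact hr2 1 le_rfl (by omega)
  · intro j hj hjq
    rcases lt_trichotomy (x j) 0 with h1 | h1 | h1
    · linarith [hsignneg j hj hjq h1]
    · linarith [hzero j hj hjq h1]
    · have hjq' := C.lt_of_ne_zero hjq h1.ne'
      rw [hpos j hj hjq' h1]
      exact hr2 j hj hjq'

theorem isConfig (K : Comparable q ℓ x x') {s : ℝ} (h0 : 0 ≤ s) (h1 : s ≤ 1) (m : ℕ) :
    IsConfig q x (pullbackPath q ℓ x x' s m) := by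
  induction m with
  | zero => exact K.isConfig_zero h0 h1
  | succ m ih => exact K.isConfig_succ ih

theorem pullbackOrbit (K : Comparable q ℓ x x') {s : ℝ} (h0 : 0 ≤ s) (h1 : s ≤ 1) :
    PullbackOrbit q x ℓ (pullbackPath q ℓ x x' s) (pullbackVel q ℓ x x' s) where
  lt m := (K.isConfig h0 h1 m).lt
  y_last m := (K.isConfig h0 h1 m).last
  v_last m := by
    cases m with
    | zero => simp [pullbackVel, K.order.last, K.last']
    | succ m => rw [pullbackVel, if_neg (by omega)]
  one_le m := (K.isConfig h0 h1 m).one_le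
  neg_le_two m := (K.isConfig h0 h1 m).neg_le_two
  le_two m := (K.isConfig h0 h1 m).le_two
  y_rec m j hj hjq := by
    have hA := (K.isConfig h0 h1 m).diff_pos K.order hj hjq
    have hℓ : ℓ j ≠ 0 := by linarith [K.two_le j]
    have hs : |(if x j < 0 then -1 else 1 : ℝ)| = 1 := by split_ifs <;> simp
    rw [pullbackPath, if_pos ⟨hj, hjq⟩, abs_mul, hs, one_mul,
      abs_of_pos (Real.rpow_pos_of_pos hA _), ← Real.rpow_mul hA.le, one_div_mul_cancel hℓ,
      Real.rpow_one]
  v_rec m j hj hjq := by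
    have hA := (K.isConfig h0 h1 m).diff_pos K.order hj hjq
    have hℓ : ℓ j ≠ 0 := by linarith [K.two_le j]
    have hs : (if x j < 0 then -1 else 1 : ℝ) ≠ 0 := by split_ifs <;> simp
    have hy : pullbackPath q ℓ x x' s (m + 1) j ≠ 0 := by
      rw [pullbackPath, if_pos ⟨hj, hjq⟩]
      exact mul_ne_zero hs (Real.rpow_pos_of_pos hA _).ne'
    rw [pullbackVel, if_pos ⟨hj, hjq⟩, mul_div_cancel_left₀ _ hy, mul_div_cancel₀ _ hℓ]

theorem hasDerivAt_pullbackPath (K : Comparable q ℓ x x') {s : ℝ} (h0 : 0 ≤ s) (h1 : s ≤ 1)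
    (m : ℕ) : ∀ j, 1 ≤ j → j ≤ q →
      HasDerivAt (fun s => pullbackPath q ℓ x x' s m j) (pullbackVel q ℓ x x' s m j) s := by
  induction m with
  | zero =>
    intro j _ _
    simp only [pullbackPath, pullbackVel]
    have h2 : HasDerivAt (fun s => (1 - s) * x j + s * x' j) (-1 * x j + 1 * x' j) s :=
      (((hasDerivAt_id s).const_sub 1).mul_const (x j)).add ((hasDerivAt_id s).mul_const (x' j))
    exact h2.congr_deriv (by ring)
  | succ m ih =>
    intro j hj hjq
    rcases eq_or_lt_of_le hjq with rfl | hjq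
    · simp only [pullbackPath, pullbackVel, lt_irrefl, and_false, if_false]
      exact hasDerivAt_const s 0
    · have hA := (K.isConfig h0 h1 m).diff_pos K.order hj hjq
      have h2 := (((ih (j + 1) (by omega) hjq).sub (ih 1 le_rfl (by omega))).rpow_const
        (p := 1 / ℓ j) (Or.inl hA.ne')).const_mul (if x j < 0 then -1 else 1 : ℝ)
      simp only [pullbackPath, pullbackVel, if_pos (show 1 ≤ j ∧ j < q from ⟨hj, hjq⟩)]
      refine HasDerivAt.congr_deriv h2 ?_
      rw [Real.rpow_sub_one (by exact hA.ne')]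
      simp only [Pi.sub_apply]
      ring

theorem pullbackPath_zero (K : Comparable q ℓ x x') (m : ℕ) :
    ∀ j, 1 ≤ j → j ≤ q → pullbackPath q ℓ x x' 0 m j = x j := by
  induction m with
  | zero => intro j _ _; simp [pullbackPath]
  | succ m ih =>
    intro j hj hjq
    rcases eq_or_lt_of_le hjq with rfl | hjq
    · rw [pullbackPath, if_neg (by omega), K.order.last]
    · have hℓ : ℓ j ≠ 0 := by linarith [K.two_le j]
      rw [pullbackPath, if_pos ⟨hj, hjq⟩, ih _ (by omega) hjq, ih 1 le_rfl (by omega),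
        ← K.pow_eq j hj hjq, ← Real.rpow_mul (abs_nonneg _), mul_one_div_cancel hℓ, Real.rpow_one]
      split_ifs with h
      · rw [abs_of_neg h]; ring
      · rw [abs_of_nonneg (not_lt.1 h), one_mul]

theorem pullbackPath_one (K : Comparable q ℓ x x') (m : ℕ) :
    ∀ j, 1 ≤ j → j ≤ q → pullbackPath q ℓ x x' 1 m j = x' j := by
  have hq := K.order.two_le
  induction m with
  | zero => intro j _ _; simp [pullbackPath]
  | succ m ih =>
    intro j hj hjq
    rcases eq_or_lt_of_le hjq with rfl | hjq
    · rw [pullbackPath, if_neg (by omega), K.last']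
    · have hℓ : ℓ j ≠ 0 := by linarith [K.two_le j]
      rw [pullbackPath, if_pos ⟨hj, hjq⟩, ih _ (by omega) hjq, ih 1 le_rfl (by omega),
        ← K.pow_eq' j hj hjq, ← Real.rpow_mul (abs_nonneg _), mul_one_div_cancel hℓ, Real.rpow_one]
      split_ifs with h
      · have := K.lt' j q hj hjq.le (by omega) le_rfl (by rwa [K.order.last])
        rw [K.last'] at this
        rw [abs_of_neg this]; ring
      · have h2 : 0 < x j := lt_of_le_of_ne (not_lt.1 h) (K.order.ne_zero j hj hjq).symm
        have := K.lt' q j (by omega) le_rfl hj hjq.le (by rwa [K.order.last])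
        rw [K.last'] at this
        rw [abs_of_pos this, one_mul]

theorem velBound_zero (K : Comparable q ℓ x x') : ∃ g, ∀ s : ℝ, 0 ≤ s → s ≤ 1 →
    VelBound q (pullbackPath q ℓ x x' s) (pullbackVel q ℓ x x' s) 0 g := by
  set d : ℕ → ℕ → ℝ := fun _ j => x' j - x j
  obtain ⟨g, hg⟩ := exists_velBound q (fun _ => x) d 0
  obtain ⟨g', hg'⟩ := exists_velBound q (fun _ => x') d 0
  refine ⟨g + g', fun s h0 h1 j k hj hjq hk hkq => ?_⟩
  have e1 := hg j k hj hjq hk hkq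
  have e2 := hg' j k hj hjq hk hkq
  simp only [relVel, pullbackPath, pullbackVel, d] at *
  by_cases hjk : j = k
  · subst hjk
    simp only [sub_self, zero_div, abs_zero] at *
    linarith
  have hpos : 0 < (x j - x k) * (x' j - x' k) := by
    rcases lt_trichotomy (x j) (x k) with h | h | h
    · have := K.lt' j k hj hjq hk hkq h
      exact mul_pos_of_neg_of_neg (by linarith) (by linarith)
    · exact absurd (K.order.inj j k hj hjq hk hkq h) hjk
    · have := K.lt' k j hk hkq hj hjq h
      exact mul_pos (by linarith) (by linarith)
  have h2 := abs_div_convexComb_le (u := x' j - x j - (x' k - x k)) h0 h1 hpos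
  rw [show (1 - s) * (x j - x k) + s * (x' j - x' k) =
    (1 - s) * x j + s * x' j - ((1 - s) * x k + s * x' k) by ring] at h2
  linarith

/-- Every level of the path joins `x 1` to `x' 1`, but its speed tends to `0`; the mean value
inequality concludes. -/
theorem first_eq (K : Comparable q ℓ x x') (hdecay : UniformDecay q x ℓ) : x' 1 = x 1 := by
  have hq := K.order.two_le
  obtain ⟨D, hD⟩ := hdecay
  obtain ⟨g, hg⟩ := K.velBound_zero
  by_contra hne
  have hpos : 0 < |x' 1 - x 1| := abs_pos.2 (sub_ne_zero.2 hne)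
  obtain ⟨n, hn⟩ := exists_div_two_pow_lt (2 ^ D * g) (b := |x' 1 - x 1| / 2) (by linarith)
  have hmv := norm_image_sub_le_of_norm_deriv_le_segment_01'
    (f := fun s => pullbackPath q ℓ x x' s (n * D) 1)
    (f' := fun s => pullbackVel q ℓ x x' s (n * D) 1) (C := 2 * (2 ^ D * g / 2 ^ n))
    (fun s hs => (K.hasDerivAt_pullbackPath hs.1 hs.2 _ 1 le_rfl (by omega)).hasDerivWithinAt)
    (fun s hs => by
      have H := K.pullbackOrbit hs.1 hs.2.le
      exact H.abs_v_one_le K.order (hD _ _ g H (hg s hs.1 hs.2.le) n))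
  simp only [K.pullbackPath_zero _ 1 le_rfl (by omega : 1 ≤ q),
    K.pullbackPath_one _ 1 le_rfl (by omega : 1 ≤ q), Real.norm_eq_abs] at hmv
  linarith

end Comparable

theorem CriticalPeriod.param_unique {ℓm ℓp c c' : ℝ} {q : ℕ} {x x' : ℕ → ℝ}
    (P : CriticalPeriod ℓm ℓp c q) (hx : ∀ j, x j = (unimodalMap ℓm ℓp c)^[j] 0)
    (P' : CriticalPeriod ℓm ℓp c' q) (hx' : ∀ j, x' j = (unimodalMap ℓm ℓp c')^[j] 0)
    (hsign : ∀ j, 1 ≤ j → j ≤ q → SignType.sign (x j) = SignType.sign (x' j))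
    (hdecay : UniformDecay q x (fun j => sideExponent ℓm ℓp (x j))) : c = c' := by
  have hexp : ∀ j, 1 ≤ j → j < q → sideExponent ℓm ℓp (x j) = sideExponent ℓm ℓp (x' j) := by
    intro j hj hjq
    have : x j < 0 ↔ x' j < 0 := by
      rw [← sign_eq_neg_one_iff, ← sign_eq_neg_one_iff, hsign j hj hjq.le]
    simp only [sideExponent, this]
  have K : Comparable q (fun j => sideExponent ℓm ℓp (x j)) x x' :=
    { order := P.criticalOrder hx
      two_le := fun j => le_sideExponent P.two_le_left P.two_le_right (x j)
      same := fun j k h => by simp only [sideExponent, h]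
      last' := P'.orbit_last hx'
      lt' := fun j k hj hjq hk hkq h =>
        P.orbit_lt_of_lt hx P' hx' hsign (q - max j k) j k (by omega) hj hk h
      one_le := (P.orbit_one_mem hx).1
      one_le' := (P'.orbit_one_mem hx').1
      le_two := fun j hj hjq => P.orbit_abs_le hx hj hjq
      le_two' := fun j hj hjq => P'.orbit_abs_le hx' hj hjq
      pow_eq := fun j _ _ => P.orbit_rec hx j
      pow_eq' := fun j hj hjq => by rw [hexp j hj hjq]; exact P'.orbit_rec hx' j }
  have := K.first_eq hdecay
  rw [P.orbit_one hx, P'.orbit_one hx'] at this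
  exact this.symm

/-! ### From kneading sequences to critical orbits. -/

theorem sign_iterate_of_kneadingSequence {f : ℝ → ℝ} {i : ℕ+ → SignType}
    (h : kneadingSequence f = i) (j : ℕ+) : SignType.sign (f^[(j : ℕ)] 0) = i j := by
  rw [← h]; rfl

theorem criticalPeriod_of_kneadingSequence {ℓm ℓp c : ℝ} {q : ℕ+} {i : ℕ+ → SignType}
    (hi : IsPeriodicKneading i q) (hm : 2 ≤ ℓm) (hp : 2 ≤ ℓp) (hq : 2 ≤ (q : ℕ))
    (h : kneadingSequence (unimodalMap ℓm ℓp c) = i) : CriticalPeriod ℓm ℓp c q where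
  two_le_left := hm
  two_le_right := hp
  two_le := hq
  iterate_eq := by
    rw [← sign_eq_zero_iff, sign_iterate_of_kneadingSequence h q]
    exact hi.zero_at
  iterate_ne j hj hjq := by
    lift j to ℕ+ using hj
    rw [← sign_ne_zero, sign_iterate_of_kneadingSequence h j]
    exact hi.ne_zero_before _ hjq

theorem negCount_le_of_kneadingSequence {f : ℝ → ℝ} {q : ℕ+} {i : ℕ+ → SignType}
    (h : kneadingSequence f = i) :
    negCount q (fun j => f^[j] 0) 1 ≤ ((Finset.Ico 1 q).filter (fun j => i j = -1)).card := by
  refine le_trans (Finset.card_le_card fun j hj => ?_)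
    (Finset.card_image_le (f := fun j : ℕ+ => (j : ℕ)))
  rw [Finset.mem_filter, Finset.mem_Ico] at hj
  lift j to ℕ+ using hj.1.1
  refine Finset.mem_image.2 ⟨j, ?_, rfl⟩
  rw [Finset.mem_filter, Finset.mem_Ico, ← sign_iterate_of_kneadingSequence h j]
  exact ⟨⟨one_le, hj.1.2⟩, sign_eq_neg_one_iff.2 hj.2⟩

theorem eq_zero_of_period_one {ℓm ℓp c : ℝ} {q : ℕ+} {i : ℕ+ → SignType}
    (hi : IsPeriodicKneading i q) (hm : 2 ≤ ℓm) (hq : (q : ℕ) = 1)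
    (h : kneadingSequence (unimodalMap ℓm ℓp c) = i) : c = 0 := by
  have h1 := sign_iterate_of_kneadingSequence h q
  rw [hi.zero_at, sign_eq_zero_iff, hq, Function.iterate_one, unimodalMap, if_pos le_rfl, abs_zero,
    Real.zero_rpow (by linarith), zero_add] at h1
  exact h1

theorem theorem1p2 (L : ℕ) (hL : 1 ≤ L) :
    ∃ ℓ₀ : ℝ, 1 < ℓ₀ ∧
      ∀ (q : ℕ+) (i : ℕ+ → SignType), IsPeriodicKneading i q →
        ((Finset.Ico 1 q).filter (fun j => i j = -1)).card ≤ L →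
        ∀ ℓm ℓp : ℝ, ℓ₀ ≤ ℓm → ℓ₀ ≤ ℓp →
          (∀ c c' : ℝ, kneadingSequence (unimodalMap ℓm ℓp c) = i →
            kneadingSequence (unimodalMap ℓm ℓp c') = i → c = c') ∧
          (∀ c : ℝ, kneadingSequence (unimodalMap ℓm ℓp c) = i →
            (∀ n < (q : ℕ), deriv ((unimodalMap ℓm ℓp c)^[n]) c ≠ 0) ∧
            0 < ∑ n ∈ Finset.range (q : ℕ), 1 / deriv ((unimodalMap ℓm ℓp c)^[n]) c) := by
  obtain ⟨ℓ₀, h2, hdecay⟩ := exists_velBound_decay L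
  refine ⟨ℓ₀, by linarith, fun q i hi hcard ℓm ℓp hm hp => ?_⟩
  have hm2 := h2.trans hm
  have hp2 := h2.trans hp
  -- For `q = 1` the critical point is fixed and `c = 0`; the pullback argument needs `q ≥ 2`.
  rcases eq_or_lt_of_le (show 1 ≤ (q : ℕ) from q.pos) with hq | hq
  · refine ⟨fun c c' h h' => ?_, fun c _ => ?_⟩
    · rw [eq_zero_of_period_one hi hm2 hq.symm h, eq_zero_of_period_one hi hm2 hq.symm h']
    · have hd : deriv ((unimodalMap ℓm ℓp c)^[0]) c = 1 := by
        rw [Function.iterate_zero]; exact deriv_id c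
      rw [← hq]
      refine ⟨fun n hn => ?_, ?_⟩
      · obtain rfl : n = 0 := by omega
        rw [hd]; exact one_ne_zero
      · rw [Finset.sum_range_one, hd]; norm_num
  · have hdec : ∀ c, kneadingSequence (unimodalMap ℓm ℓp c) = i →
        UniformDecay q (fun j => (unimodalMap ℓm ℓp c)^[j] 0)
          (fun j => sideExponent ℓm ℓp ((unimodalMap ℓm ℓp c)^[j] 0)) := fun c h =>
      hdecay q _ _ ((criticalPeriod_of_kneadingSequence hi hm2 hp2 hq h).criticalOrder
        fun _ => rfl) ((negCount_le_of_kneadingSequence h).trans hcard)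
        (fun j => le_sideExponent hm hp _) (fun j k hjk => by simp only [sideExponent, hjk])
    refine ⟨fun c c' h h' => ?_, fun c h => ?_⟩
    · refine (criticalPeriod_of_kneadingSequence hi hm2 hp2 hq h).param_unique (fun _ => rfl)
        (criticalPeriod_of_kneadingSequence hi hm2 hp2 hq h') (fun _ => rfl)
        (fun j hj _ => ?_) (hdec c h)
      lift j to ℕ+ using hj
      rw [sign_iterate_of_kneadingSequence h j, sign_iterate_of_kneadingSequence h' j]
    · have P := criticalPeriod_of_kneadingSequence hi hm2 hp2 hq h
      refine ⟨fun n hn => ?_, P.sum_one_div_deriv_pos (fun _ => rfl) (hdec c h)⟩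
      rw [P.deriv_iterate (fun _ => rfl) hn]
      exact P.prod_slope_ne_zero (fun _ => rfl) hn
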